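/- Let $X$ be a proper CAT(0) space. For a point $x$ of a metric space $Y$, $\partial_x Y$ denotes the set of geodesic rays $c:[0,\infty)\to Y$ with $c(0)=x$, with the cone topology, generated by the sets $\{c' : d(c(r),c'(r))<D\}$ ($c\in\partial_xY$, $r,D>0$); for proper CAT(0) spaces it does not depend on $x$ up to homeomorphism and is the visual boundary $\partial Y$. A \emph{block decomposition} of $X$ is a collection $\mathcal B$ of closed convex subsets of $X$ (blocks) such that: (i) $X=\bigcup_{B\in\mathcal B}B$; (ii) each block intersects at least two other blocks; (iii) each block can be given a parity $+$ or $-$ so that two distinct blocks intersect only if they have opposite parity; (iv) there is $\epsilon>0$ such that two blocks intersect if and only if their $\epsilon$-neighborhoods intersect. A \emph{wall} is a nonempty intersection of two distinct blocks. Fix a basepoint $x_0\in X$ that lies in no wall. A geodesic ray $c$ from $x_0$ \emph{enters} a block $B$ if for some $t$ the point $c(t)$ lies in $B$ and in no other block. The \emph{itinerary} of $c$ is the sequence of blocks that $c$ enters, in order. The ray $c$ is \emph{irrational} if its itinerary is infinite; an irrational ray from $x_0$ is \emph{lonely} if no other geodesic ray from $x_0$ has the same itinerary. \textbf{Theorem.}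 Let $X$ be a proper CAT(0) space, $\mathcal B$ a block decomposition of $X$, and $x_0\in X$ a point that lies in no wall. Suppose that (1) for each block $B$, the visual boundary $\partial B$ is path connected; (2) for each wall $W$, the visual boundary $\partial W$ is nonempty; (3) every irrational ray from $x_0$ is lonely. Then $\partial X$ is path connected (that is, $\partial_x X$ is path connected for every $x\in X$). -/

import Mathlib

open scoped NNReal

/-- A metric space is geodesic if any two points are joined by a geodesic segment. -/
def IsGeodesicSpace (X : Type*) [MetricSpace X] : Prop :=
  ∀ x y : X, ∃ γ : ℝ → X, γ 0 = x ∧ γ (dist x y) = y ∧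
    ∀ s ∈ Set.Icc 0 (dist x y), ∀ t ∈ Set.Icc 0 (dist x y), dist (γ s) (γ t) = |s - t|

/-- `z` lies on a geodesic segment from `x` to `y` (in a geodesic space this is equivalent to
equality in the triangle inequality). -/
def MetricBtw {X : Type*} [MetricSpace X] (x z y : X) : Prop :=
  dist x z + dist z y = dist x y

/-- A CAT(0) space: a geodesic space in which geodesic triangles are no fatter than their
comparison triangles in the Euclidean plane. Here `p q r` is the triangle, `x` is a point of the
side `[p, q]`, `y` is a point of the side `[p, r]`, and `p' q' r'`, `x'`, `y'` are the comparison
triangle and the comparison points. -/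
structure IsCAT0 (X : Type*) [MetricSpace X] : Prop where
  geodesic : IsGeodesicSpace X
  comparison : ∀ (p q r x y : X) (p' q' r' x' y' : EuclideanSpace ℝ (Fin 2)),
    MetricBtw p x q → MetricBtw p y r →
    dist p' q' = dist p q → dist q' r' = dist q r → dist p' r' = dist p r →
    dist p' x' = dist p x → dist x' q' = dist x q →
    dist p' y' = dist p y → dist y' r' = dist y r →
    dist x y ≤ dist x' y'

/-- A subset is (geodesically) convex if it contains every geodesic segment between its points. -/
def GeodConvex {X : Type*} [MetricSpace X] (C : Set X) : Prop :=
  ∀ x ∈ C, ∀ y ∈ C, ∀ z, MetricBtw x z y → z ∈ C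

/-- The visual boundary `∂ₓX` seen from the basepoint `x`: the set of geodesic rays
`[0, ∞) → X` starting at `x`. -/
@[ext]
structure VisualBoundary {X : Type*} [MetricSpace X] (x : X) where
  ray : ℝ≥0 → X
  isometry_ray : Isometry ray
  ray_zero : ray 0 = x

namespace VisualBoundary

/-- The basic set `U(c, r, D)` of the cone topology. -/
def basicNhd {X : Type*} [MetricSpace X] {x : X} (c : VisualBoundary x) (r : ℝ≥0) (D : ℝ) :
    Set (VisualBoundary x) :=
  {c' | dist (c.ray r) (c'.ray r) < D}

/-- The cone topology on the visual boundary. -/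
instance coneTopology {X : Type*} [MetricSpace X] (x : X) :
    TopologicalSpace (VisualBoundary x) :=
  TopologicalSpace.generateFrom
    {U | ∃ (c : VisualBoundary x) (r : ℝ≥0) (D : ℝ), 0 < r ∧ 0 < D ∧ U = basicNhd c r D}

end VisualBoundary

/-- A block decomposition of a CAT(0) space. -/
structure IsBlockDecomposition {X : Type*} [MetricSpace X] (𝓑 : Set (Set X)) : Prop where
  isClosed : ∀ B ∈ 𝓑, IsClosed B
  convex : ∀ B ∈ 𝓑, GeodConvex B
  cover : ⋃₀ 𝓑 = Set.univ
  two_neighbours : ∀ B ∈ 𝓑, ∃ B₁ ∈ 𝓑, ∃ B₂ ∈ 𝓑, B₁ ≠ B ∧ B₂ ≠ B ∧ B₁ ≠ B₂ ∧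
    (B ∩ B₁).Nonempty ∧ (B ∩ B₂).Nonempty
  parity : ∃ σ : Set X → Bool, ∀ B ∈ 𝓑, ∀ B' ∈ 𝓑, B ≠ B' → (B ∩ B').Nonempty → σ B ≠ σ B'
  epsilon : ∃ ε : ℝ, 0 < ε ∧ ∀ B ∈ 𝓑, ∀ B' ∈ 𝓑,
    ((B ∩ B').Nonempty ↔ (Metric.thickening ε B ∩ Metric.thickening ε B').Nonempty)

/-- The walls: the nonempty intersections of two distinct blocks. -/
def walls {X : Type*} (𝓑 : Set (Set X)) : Set (Set X) :=
  {W | ∃ B ∈ 𝓑, ∃ B' ∈ 𝓑, B ≠ B' ∧ W = B ∩ B' ∧ W.Nonempty}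

/-- The point `y` lies in the block `B` and in no other block. -/
def InOnly {X : Type*} (𝓑 : Set (Set X)) (B : Set X) (y : X) : Prop :=
  B ∈ 𝓑 ∧ y ∈ B ∧ ∀ B' ∈ 𝓑, B' ≠ B → y ∉ B'

/-- The ray `c` enters the block `B`. -/
def Enters {X : Type*} [MetricSpace X] (𝓑 : Set (Set X)) {x : X} (c : VisualBoundary x)
    (B : Set X) : Prop :=
  ∃ t : ℝ≥0, InOnly 𝓑 B (c.ray t)

/-- The ray `c` enters the block `B` and, at a later time, the block `B'`. -/
def EntersBefore {X : Type*} [MetricSpace X] (𝓑 : Set (Set X)) {x : X} (c : VisualBoundary x)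
    (B B' : Set X) : Prop :=
  ∃ s t : ℝ≥0, s < t ∧ InOnly 𝓑 B (c.ray s) ∧ InOnly 𝓑 B' (c.ray t)

/-- Two rays have the same itinerary: they enter the same blocks in the same order. (Blocks are
convex, so a ray never comes back to a block it has left; hence the sequence of blocks that a ray
enters has no repetitions, and is given by its set of terms and their order.) -/
def SameItinerary {X : Type*} [MetricSpace X] (𝓑 : Set (Set X)) {x : X}
    (c c' : VisualBoundary x) : Prop :=
  (∀ B, Enters 𝓑 c B ↔ Enters 𝓑 c' B) ∧
    ∀ B B', B ≠ B' → (EntersBefore 𝓑 c B B' ↔ EntersBefore 𝓑 c' B B')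

/-- A boundary point is irrational if its itinerary is infinite. -/
def IsIrrational {X : Type*} [MetricSpace X] (𝓑 : Set (Set X)) {x : X}
    (c : VisualBoundary x) : Prop :=
  {B | Enters 𝓑 c B}.Infinite

/-- A boundary point is lonely if it is irrational and the only boundary point with its
itinerary. -/
def IsLonely {X : Type*} [MetricSpace X] (𝓑 : Set (Set X)) {x : X}
    (c : VisualBoundary x) : Prop :=
  IsIrrational 𝓑 c ∧ ∀ c' : VisualBoundary x, SameItinerary 𝓑 c' c → c' = c

open Filter Topology

/-! The boundaries of the blocks hang together. A ray in a wall is a ray in both adjacent blocks, so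
the boundaries of two intersecting blocks share a point. As blocks that come close to each other
intersect, the boundaries of the blocks filling any connected union of blocks form a path connected
set (`joinedIn_iUnion_asymptoticTo`). Applied to the whole space, this joins all rational rays,
since such a ray finally stays in one block (`exists_block_of_not_isIrrational`).

Let `a` be an irrational ray that cannot be joined to a rational one. It crosses walls `W n`
arbitrarily far out, and each wall separates the space into two convex sides (`exists_sides`,
`far_convex`). The far side is a connected union of blocks, so block boundaries beyond `W n` can be
joined to block boundaries beyond `W (n + 1)` without leaving the boundary of the far side of `W n`.
These infinitely many paths concatenate to a path ending at `a` (`joined_of_joinedIn_of_tendsto`),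
provided that the walls, seen from `x₀`, shrink to `a`.

If they did not shrink, then inside the walls there would be segments from the ray `a` to points `q
n` seen far from `a`, and on them points `y n` seen at an intermediate distance. In the limit these
give rays `b` and `c`, with `c` different from `a` and `b`. Comparison angles at `x₀` over `[a, y]`
and `[y, q]` add up to at most `π` (`dist_gpt_sq_add_le`), and the second stays away from `0`, so
`a` and `c` diverge at a rate less than `2` and can be joined (`joined_of_dist_ray_le`). Hence `c`
is irrational too. As a limit of points of walls crossed by `a`, it crosses exactly the walls that
`a` crosses (`Gate.Crossed.of_limit`, `Gate.Crossed.of_isIrrational`), so it has the itinerary of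
`a`, and loneliness gives `c = a`, a contradiction. -/

/-! ### Comparison triangles and geodesic segments -/

theorem exists_comparison_triangle {A B C : ℝ} (hA : 0 ≤ A) (hB : 0 ≤ B) (hC : 0 ≤ C)
    (h1 : C ≤ A + B) (h2 : A ≤ B + C) (h3 : B ≤ A + C) :
    ∃ q r : EuclideanSpace ℝ (Fin 2), ‖q‖ = A ∧ ‖r‖ = B ∧ ‖q - r‖ = C := by
  rcases hA.eq_or_lt with rfl | hA'
  · have hBC : B = C := by linarith
    subst hBC
    refine ⟨0, !₂[B, 0], by simp, ?_, ?_⟩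
    · simp [EuclideanSpace.norm_eq, Real.sqrt_sq hB]
    · simp [EuclideanSpace.norm_eq, Real.sqrt_sq hB]
  -- With `q` on the first axis, the law of cosines forces this first coordinate of `r`.
  · set u : ℝ := (A ^ 2 + B ^ 2 - C ^ 2) / (2 * A) with hu
    have huA : 2 * A * u = A ^ 2 + B ^ 2 - C ^ 2 := by rw [hu]; field_simp
    have hu2 : u ^ 2 ≤ B ^ 2 := by
      apply sq_le_sq'
      · by_contra hcon
        have : 2 * A * u < 2 * A * (-B) := by gcongr; linarith
        nlinarith
      · by_contra hcon
        have : 2 * A * B < 2 * A * u := by gcongr; linarith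
        nlinarith
    have hv : (√(B ^ 2 - u ^ 2)) ^ 2 = B ^ 2 - u ^ 2 := Real.sq_sqrt (by linarith)
    refine ⟨!₂[A, 0], !₂[u, √(B ^ 2 - u ^ 2)], ?_, ?_, ?_⟩
    · simp [EuclideanSpace.norm_eq, Real.sqrt_sq hA]
    · simp only [EuclideanSpace.norm_eq, Fin.sum_univ_two, Real.norm_eq_abs, sq_abs]
      simp only [Matrix.cons_val_zero, Matrix.cons_val_one]
      conv_rhs => rw [← Real.sqrt_sq hB]
      rw [hv]; congr 1; ring
    · simp only [EuclideanSpace.norm_eq, Fin.sum_univ_two, Real.norm_eq_abs, sq_abs, PiLp.sub_apply]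
      simp only [Matrix.cons_val_zero, Matrix.cons_val_one]
      conv_rhs => rw [← Real.sqrt_sq hC]
      congr 1
      nlinarith

/-- The law of cosines as an inequality between points on two sides of a geodesic triangle. -/
theorem IsCAT0.dist_sq_le {X : Type*} [MetricSpace X] (hX : IsCAT0 X) {p q r x y : X} {s t : ℝ}
    (hs : 0 ≤ s) (hs1 : s ≤ 1) (ht : 0 ≤ t) (ht1 : t ≤ 1)
    (hpx : dist p x = s * dist p q) (hxq : dist x q = (1 - s) * dist p q)
    (hpy : dist p y = t * dist p r) (hyr : dist y r = (1 - t) * dist p r) :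
    dist x y ^ 2 ≤ s ^ 2 * dist p q ^ 2 + t ^ 2 * dist p r ^ 2 -
      s * t * (dist p q ^ 2 + dist p r ^ 2 - dist q r ^ 2) := by
  obtain ⟨q', r', hq, hr, hqr⟩ := exists_comparison_triangle (A := dist p q) (B := dist p r)
    (C := dist q r) dist_nonneg dist_nonneg dist_nonneg
    (by rw [dist_comm p q]; exact dist_triangle _ _ _)
    (by rw [dist_comm q r]; exact dist_triangle _ _ _)
    (dist_triangle _ _ _)
  have key := hX.comparison p q r x y 0 q' r' (s • q') (t • r')
    (by unfold MetricBtw; rw [hpx, hxq]; ring) (by unfold MetricBtw; rw [hpy, hyr]; ring)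
    (by simp [hq]) (by rw [dist_eq_norm, hqr]) (by simp [hr])
    (by rw [dist_zero_left, norm_smul, hq, hpx, Real.norm_of_nonneg hs])
    (by
      rw [dist_comm, dist_eq_norm, show q' - s • q' = (1 - s) • q' by rw [sub_smul, one_smul],
        norm_smul, hq, hxq, Real.norm_of_nonneg (by linarith)])
    (by rw [dist_zero_left, norm_smul, hr, hpy, Real.norm_of_nonneg ht])
    (by
      rw [dist_comm, dist_eq_norm, show r' - t • r' = (1 - t) • r' by rw [sub_smul, one_smul],
        norm_smul, hr, hyr, Real.norm_of_nonneg (by linarith)])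
  have h2 : dist (s • q') (t • r') ^ 2 = s ^ 2 * dist p q ^ 2 + t ^ 2 * dist p r ^ 2 -
      s * t * (dist p q ^ 2 + dist p r ^ 2 - dist q r ^ 2) := by
    have e1 := norm_sub_sq_real q' r'
    rw [hq, hr, hqr] at e1
    rw [dist_eq_norm, norm_sub_sq_real, norm_smul, norm_smul, hq, hr, real_inner_smul_left,
      real_inner_smul_right, Real.norm_of_nonneg hs, Real.norm_of_nonneg ht]
    linear_combination -s * t * e1
  rw [← h2]
  gcongr

/-- The point at the proportion `l` on a geodesic segment from `x` to `y`. -/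
noncomputable def seg {X : Type*} [MetricSpace X] (x y : X) (l : ℝ) : X :=
  open Classical in
  if h : ∃ z, dist x z = l * dist x y ∧ dist z y = (1 - l) * dist x y then h.choose else x

theorem IsCAT0.seg_spec {X : Type*} [MetricSpace X] (hX : IsCAT0 X) (x y : X) {l : ℝ}
    (h0 : 0 ≤ l) (h1 : l ≤ 1) :
    dist x (seg x y l) = l * dist x y ∧ dist (seg x y l) y = (1 - l) * dist x y := by
  have h : ∃ z, dist x z = l * dist x y ∧ dist z y = (1 - l) * dist x y := by
    obtain ⟨γ, g0, g1, hγ⟩ := hX.geodesic x y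
    have hd : 0 ≤ dist x y := dist_nonneg
    have hm : l * dist x y ∈ Set.Icc 0 (dist x y) :=
      ⟨by positivity, mul_le_of_le_one_left hd h1⟩
    refine ⟨γ (l * dist x y), ?_, ?_⟩
    · have := hγ 0 ⟨le_rfl, hd⟩ _ hm
      rwa [g0, zero_sub, abs_neg, abs_of_nonneg hm.1] at this
    · have := hγ _ hm _ ⟨hd, le_rfl⟩
      rw [g1, abs_sub_comm, abs_of_nonneg (by linarith [hm.2])] at this
      rw [this]; ring
  unfold seg
  rw [dif_pos h]
  exact h.choose_spec

theorem IsCAT0.btw_seg {X : Type*} [MetricSpace X] (hX : IsCAT0 X) (x y : X) {l : ℝ}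
    (h0 : 0 ≤ l) (h1 : l ≤ 1) : MetricBtw x (seg x y l) y := by
  obtain ⟨a, b⟩ := hX.seg_spec x y h0 h1
  unfold MetricBtw
  rw [a, b]; ring

/-- Thales' inequality. -/
theorem IsCAT0.dist_le_of_same_ratio {X : Type*} [MetricSpace X] (hX : IsCAT0 X) {p q r x y : X}
    {s : ℝ} (hs : 0 ≤ s) (hs1 : s ≤ 1)
    (hpx : dist p x = s * dist p q) (hxq : dist x q = (1 - s) * dist p q)
    (hpy : dist p y = s * dist p r) (hyr : dist y r = (1 - s) * dist p r) :
    dist x y ≤ s * dist q r := by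
  have := hX.dist_sq_le hs hs1 hs hs1 hpx hxq hpy hyr
  refine abs_le_of_sq_le_sq' ?_ (by positivity) |>.2
  linarith

/-- Uniqueness of geodesics: Thales' inequality in the degenerate triangle whose third side is a
point. -/
theorem IsCAT0.eq_seg {X : Type*} [MetricSpace X] (hX : IsCAT0 X) {x y z : X} {l : ℝ}
    (h0 : 0 ≤ l) (h1 : l ≤ 1) (hxz : dist x z = l * dist x y)
    (hzy : dist z y = (1 - l) * dist x y) : z = seg x y l := by
  obtain ⟨a, b⟩ := hX.seg_spec x y h0 h1
  have := hX.dist_le_of_same_ratio h0 h1 hxz hzy a b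
  rw [dist_self, mul_zero] at this
  exact dist_le_zero.1 this

theorem IsCAT0.seg_zero {X : Type*} [MetricSpace X] (hX : IsCAT0 X) (x y : X) :
    seg x y 0 = x := (hX.eq_seg le_rfl zero_le_one (by simp) (by simp)).symm

theorem IsCAT0.seg_one {X : Type*} [MetricSpace X] (hX : IsCAT0 X) (x y : X) :
    seg x y 1 = y := (hX.eq_seg zero_le_one le_rfl (by simp) (by simp)).symm

theorem IsCAT0.seg_symm {X : Type*} [MetricSpace X] (hX : IsCAT0 X) (x y : X) {l : ℝ}
    (h0 : 0 ≤ l) (h1 : l ≤ 1) : seg x y l = seg y x (1 - l) := by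
  obtain ⟨a, b⟩ := hX.seg_spec x y h0 h1
  refine hX.eq_seg (by linarith) (by linarith) ?_ ?_
  · rw [dist_comm, b, dist_comm y x]
  · rw [dist_comm, a, dist_comm y x]; ring

theorem IsCAT0.dist_seg_right {X : Type*} [MetricSpace X] (hX : IsCAT0 X) (x y z : X) {l : ℝ}
    (h0 : 0 ≤ l) (h1 : l ≤ 1) : dist (seg x y l) (seg x z l) ≤ l * dist y z := by
  obtain ⟨a, b⟩ := hX.seg_spec x y h0 h1
  obtain ⟨c, d⟩ := hX.seg_spec x z h0 h1
  exact hX.dist_le_of_same_ratio h0 h1 a b c d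

theorem IsCAT0.dist_seg_left {X : Type*} [MetricSpace X] (hX : IsCAT0 X) (x y z : X) {l : ℝ}
    (h0 : 0 ≤ l) (h1 : l ≤ 1) : dist (seg x z l) (seg y z l) ≤ (1 - l) * dist x y := by
  rw [hX.seg_symm x z h0 h1, hX.seg_symm y z h0 h1]
  exact hX.dist_seg_right z x y (by linarith) (by linarith)

theorem IsCAT0.dist_seg_seg {X : Type*} [MetricSpace X] (hX : IsCAT0 X) (x y : X) {l m : ℝ}
    (h0 : 0 ≤ l) (h1 : l ≤ 1) (k0 : 0 ≤ m) (k1 : m ≤ 1) :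
    dist (seg x y l) (seg x y m) = |l - m| * dist x y := by
  obtain ⟨a, b⟩ := hX.seg_spec x y h0 h1
  obtain ⟨c, d⟩ := hX.seg_spec x y k0 k1
  have h := hX.dist_sq_le h0 h1 k0 k1 a b c d
  rw [dist_self] at h
  apply le_antisymm
  · refine abs_le_of_sq_le_sq' ?_ (by positivity) |>.2
    rw [mul_pow, sq_abs]
    linarith
  · have h1 := abs_dist_sub_le (seg x y l) (seg x y m) x
    rwa [dist_comm _ x, dist_comm _ x, a, c, ← sub_mul, abs_mul, abs_of_nonneg dist_nonneg] at h1

/-- The Bruhat–Tits inequality. -/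
theorem IsCAT0.dist_sq_seg_le {X : Type*} [MetricSpace X] (hX : IsCAT0 X) (p x y : X) {l : ℝ}
    (h0 : 0 ≤ l) (h1 : l ≤ 1) : dist p (seg x y l) ^ 2 ≤
      (1 - l) * dist p x ^ 2 + l * dist p y ^ 2 - l * (1 - l) * dist x y ^ 2 := by
  obtain ⟨a, b⟩ := hX.seg_spec x y h0 h1
  have := hX.dist_sq_le (p := x) (q := p) (r := y) (x := p) (s := 1) zero_le_one le_rfl h0 h1
    (by simp) (by simp) a b
  rw [dist_comm x p] at this
  linarith

theorem IsCAT0.dist_seg_le {X : Type*} [MetricSpace X] (hX : IsCAT0 X) (x y x' y' : X) {l m : ℝ}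
    (h0 : 0 ≤ l) (h1 : l ≤ 1) (k0 : 0 ≤ m) (k1 : m ≤ 1) :
    dist (seg x y l) (seg x' y' m) ≤ dist x x' + dist y y' + |l - m| * dist x y := by
  have a := hX.dist_seg_seg x y h0 h1 k0 k1
  have b := hX.dist_seg_right x y y' k0 k1
  have c := hX.dist_seg_left x x' y' k0 k1
  have d := dist_triangle4 (seg x y l) (seg x y m) (seg x y' m) (seg x' y' m)
  have e : m * dist y y' ≤ dist y y' := mul_le_of_le_one_left dist_nonneg k1
  have f : (1 - m) * dist x x' ≤ dist x x' := mul_le_of_le_one_left dist_nonneg (by linarith)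
  linarith

theorem IsCAT0.continuousOn_seg {X : Type*} [MetricSpace X] (hX : IsCAT0 X) :
    ContinuousOn (fun u : X × X × ℝ => seg u.1 u.2.1 u.2.2) {u | u.2.2 ∈ Set.Icc 0 1} := by
  rintro ⟨x, y, l⟩ ⟨h0, h1⟩
  rw [ContinuousWithinAt, tendsto_iff_dist_tendsto_zero]
  have hlim : Filter.Tendsto (fun u : X × X × ℝ => dist x u.1 + dist y u.2.1 +
      |l - u.2.2| * dist x y) (nhdsWithin (x, y, l) {u | u.2.2 ∈ Set.Icc 0 1}) (nhds 0) := by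
    have : Continuous (fun u : X × X × ℝ => dist x u.1 + dist y u.2.1 +
      |l - u.2.2| * dist x y) := by fun_prop
    have h := this.tendsto (x, y, l)
    simp only [dist_self, sub_self, abs_zero, zero_mul, add_zero] at h
    exact h.mono_left nhdsWithin_le_nhds
  refine squeeze_zero' (Filter.Eventually.of_forall fun _ => dist_nonneg) ?_ hlim
  filter_upwards [self_mem_nhdsWithin] with u hu
  rw [dist_comm]
  exact hX.dist_seg_le x y u.1 u.2.1 h0 h1 hu.1 hu.2

theorem IsCAT0.continuousOn_seg_param {X : Type*} [MetricSpace X] (hX : IsCAT0 X) (x y : X) :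
    ContinuousOn (fun l : ℝ => seg x y l) (Set.Icc 0 1) :=
  hX.continuousOn_seg.comp (f := fun l : ℝ => (x, y, l)) (by fun_prop) fun _ hl => hl

theorem IsCAT0.seg_mem {X : Type*} [MetricSpace X] (hX : IsCAT0 X) {C : Set X}
    (hC : GeodConvex C) {x y : X} (hx : x ∈ C) (hy : y ∈ C) {l : ℝ}
    (h0 : 0 ≤ l) (h1 : l ≤ 1) : seg x y l ∈ C :=
  hC x hx y hy _ (hX.btw_seg x y h0 h1)

theorem IsCAT0.isPreconnected {X : Type*} [MetricSpace X] (hX : IsCAT0 X) {C : Set X}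
    (hC : GeodConvex C) : IsPreconnected C := by
  refine isPreconnected_of_forall_pair fun x hx y hy =>
    ⟨seg x y '' Set.Icc 0 1, ?_, ⟨0, by simp, hX.seg_zero x y⟩, ⟨1, by simp, hX.seg_one x y⟩,
      isPreconnected_Icc.image _ (hX.continuousOn_seg_param x y)⟩
  rintro _ ⟨l, hl, rfl⟩
  exact hX.seg_mem hC hx hy hl.1 hl.2

/-! ### Radial projection to the sphere of radius `r` -/

/-- The point at distance `r` from `x` on a geodesic segment from `x` to `y`. -/
noncomputable def gpt {X : Type*} [MetricSpace X] (x y : X) (r : ℝ) : X :=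
  seg x y (r / dist x y)

theorem IsCAT0.gpt_spec {X : Type*} [MetricSpace X] (hX : IsCAT0 X) (x y : X) {r : ℝ}
    (h0 : 0 ≤ r) (h1 : r ≤ dist x y) :
    dist x (gpt x y r) = r ∧ dist (gpt x y r) y = dist x y - r := by
  obtain ⟨a, b⟩ := hX.seg_spec x y (l := r / dist x y) (by positivity)
    (div_le_one_of_le₀ h1 dist_nonneg)
  unfold gpt
  rw [a, b]
  rcases eq_or_ne (dist x y) 0 with h | h
  · rw [h] at h1 ⊢
    constructor <;> simp <;> linarith
  · constructor <;> field_simp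

theorem IsCAT0.eq_gpt {X : Type*} [MetricSpace X] (hX : IsCAT0 X) {x y z : X} {r : ℝ}
    (hxz : dist x z = r) (hzy : dist z y = dist x y - r) : z = gpt x y r := by
  have h0 : 0 ≤ r := hxz ▸ dist_nonneg
  have h1 : r ≤ dist x y := by linarith [dist_nonneg (x := z) (y := y)]
  unfold gpt
  refine hX.eq_seg (by positivity) (div_le_one_of_le₀ h1 dist_nonneg) ?_ ?_
  all_goals
    rcases eq_or_ne (dist x y) 0 with h | h
    · obtain rfl : r = 0 := le_antisymm (h ▸ h1) h0
      simp [h, hxz, hzy]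
    · first
      | rw [hxz]; field_simp
      | rw [hzy]; field_simp

theorem IsCAT0.gpt_mem {X : Type*} [MetricSpace X] (hX : IsCAT0 X) {C : Set X}
    (hC : GeodConvex C) {x y : X} (hx : x ∈ C) (hy : y ∈ C) {r : ℝ}
    (h0 : 0 ≤ r) (h1 : r ≤ dist x y) : gpt x y r ∈ C :=
  hX.seg_mem hC hx hy (by positivity) (div_le_one_of_le₀ h1 dist_nonneg)

theorem IsCAT0.dist_gpt_gpt {X : Type*} [MetricSpace X] (hX : IsCAT0 X) (x y : X) {r s : ℝ}
    (h0 : 0 ≤ r) (h1 : r ≤ dist x y) (k0 : 0 ≤ s) (k1 : s ≤ dist x y) :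
    dist (gpt x y r) (gpt x y s) = |r - s| := by
  unfold gpt
  rw [hX.dist_seg_seg x y (by positivity) (div_le_one_of_le₀ h1 dist_nonneg) (by positivity)
    (div_le_one_of_le₀ k1 dist_nonneg)]
  rcases eq_or_ne (dist x y) 0 with h | h
  · rw [h] at h1 k1 ⊢
    rw [le_antisymm h1 h0, le_antisymm k1 k0]; simp
  · rw [← sub_div, abs_div, abs_of_nonneg (dist_nonneg (x := x) (y := y))]
    field_simp

theorem IsCAT0.gpt_of_btw {X : Type*} [MetricSpace X] (hX : IsCAT0 X) {x z y : X}
    (h : MetricBtw x z y) {r : ℝ} (h0 : 0 ≤ r) (h1 : r ≤ dist x z) :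
    gpt x z r = gpt x y r := by
  obtain ⟨a, b⟩ := hX.gpt_spec x z h0 h1
  refine hX.eq_gpt a (le_antisymm ?_ ?_)
  · have := dist_triangle (gpt x z r) z y
    unfold MetricBtw at h
    linarith
  · linarith [dist_triangle x (gpt x z r) y]

theorem IsCAT0.dist_gpt_le {X : Type*} [MetricSpace X] (hX : IsCAT0 X) (x p q : X) {r : ℝ}
    (h0 : 0 < r) (hp : r ≤ dist x p) (hq : r ≤ dist x q) :
    dist (gpt x p r) (gpt x q r) ≤ 2 * r * dist p q / dist x p := by
  have pp : 0 < dist x p := h0.trans_le hp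
  have qq : 0 < dist x q := h0.trans_le hq
  have a := hX.dist_seg_right x p q (l := r / dist x p) (by positivity)
    (div_le_one_of_le₀ hp dist_nonneg)
  have b := hX.dist_seg_seg x q (l := r / dist x p) (m := r / dist x q) (by positivity)
    (div_le_one_of_le₀ hp dist_nonneg) (by positivity) (div_le_one_of_le₀ hq dist_nonneg)
  have c := dist_triangle (seg x p (r / dist x p)) (seg x q (r / dist x p))
    (seg x q (r / dist x q))
  have d : |r / dist x p - r / dist x q| * dist x q ≤ r / dist x p * dist p q := by
    have e : r / dist x p - r / dist x q = r / dist x p / dist x q * (dist x q - dist x p) := by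
      field_simp
    rw [e, abs_mul, abs_of_nonneg (a := r / dist x p / dist x q) (by positivity)]
    have f : |dist x q - dist x p| ≤ dist p q := by
      have := abs_dist_sub_le q p x
      rwa [dist_comm q x, dist_comm p x, dist_comm q p] at this
    calc _ = r / dist x p * |dist x q - dist x p| := by field_simp
      _ ≤ _ := by gcongr
  unfold gpt
  calc _ ≤ _ := c
    _ ≤ r / dist x p * dist p q + r / dist x p * dist p q := by rw [b]; gcongr
    _ = _ := by ring

/-- If `y` lies between `p` and `q`, then the comparison angles that `[p, y]` and `[y, q]` subtend
at `x` add up to at most `π`. -/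
theorem IsCAT0.dist_gpt_sq_add_le {X : Type*} [MetricSpace X] (hX : IsCAT0 X) {x p y q : X}
    (h : MetricBtw p y q) {s : ℝ} (h0 : 0 < s) (hp : s ≤ dist x p) (hy : s ≤ dist x y)
    (hq : s ≤ dist x q) :
    dist (gpt x p s) (gpt x y s) ^ 2 + dist (gpt x y s) (gpt x q s) ^ 2 ≤ 4 * s ^ 2 := by
  have pp : 0 < dist x p := h0.trans_le hp
  have qq : 0 < dist x q := h0.trans_le hq
  have yy : 0 < dist x y := h0.trans_le hy
  have sp := hX.seg_spec x p (l := s / dist x p) (by positivity)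
    (div_le_one_of_le₀ hp dist_nonneg)
  have sy := hX.seg_spec x y (l := s / dist x y) (by positivity)
    (div_le_one_of_le₀ hy dist_nonneg)
  have sq := hX.seg_spec x q (l := s / dist x q) (by positivity)
    (div_le_one_of_le₀ hq dist_nonneg)
  have e1 := hX.dist_sq_le (by positivity) (div_le_one_of_le₀ hp dist_nonneg) (by positivity)
    (div_le_one_of_le₀ hy dist_nonneg) sp.1 sp.2 sy.1 sy.2
  have e2 := hX.dist_sq_le (by positivity) (div_le_one_of_le₀ hy dist_nonneg) (by positivity)
    (div_le_one_of_le₀ hq dist_nonneg) sy.1 sy.2 sq.1 sq.2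
  have t1 : dist p q ≤ dist x p + dist x q := dist_triangle_left _ _ _
  have t2 : dist p y ≤ dist x p + dist x y := dist_triangle_left _ _ _
  have t3 : dist x p ≤ dist x y + dist p y := by
    rw [dist_comm p y]; exact dist_triangle _ _ _
  have v0 : 0 ≤ dist y q := dist_nonneg
  unfold MetricBtw at h
  unfold gpt
  generalize dist x p = a at *
  generalize dist x y = c at *
  generalize dist x q = b at *
  generalize dist p y = u at *
  generalize dist y q = v at *
  -- This is nonnegativity of the sum of the two comparison cosines at `x`, with denominators
  -- cleared. It is an equality for `v = a + b - u` and `c = |u - a|`; the triangle inequalities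
  -- give the rest.
  have key : b * u ^ 2 + a * v ^ 2 ≤ (a + b) * (a * b + c ^ 2) := by
    have hv : v ^ 2 ≤ (a + b - u) ^ 2 := by
      apply sq_le_sq' <;> linarith
    have hx2 : (u - a) ^ 2 ≤ c ^ 2 := by
      apply sq_le_sq' <;> linarith
    nlinarith
  have key2 : 0 ≤ s / a * (s / c) * (a ^ 2 + c ^ 2 - u ^ 2) +
      s / c * (s / b) * (c ^ 2 + b ^ 2 - v ^ 2) := by
    have : s / a * (s / c) * (a ^ 2 + c ^ 2 - u ^ 2) +
      s / c * (s / b) * (c ^ 2 + b ^ 2 - v ^ 2) = s ^ 2 / (a * b * c) *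
        ((a + b) * (a * b + c ^ 2) - (b * u ^ 2 + a * v ^ 2)) := by
      field_simp; ring
    rw [this]
    exact mul_nonneg (by positivity) (by linarith)
  have f1 : (s / a) ^ 2 * a ^ 2 = s ^ 2 := by field_simp
  have f2 : (s / b) ^ 2 * b ^ 2 = s ^ 2 := by field_simp
  have f3 : (s / c) ^ 2 * c ^ 2 = s ^ 2 := by field_simp
  linarith

/-! ### Rays, the cone topology and change of base point -/

namespace VisualBoundary

theorem dist_ray {X : Type*} [MetricSpace X] {x : X} (c : VisualBoundary x) (s t : ℝ≥0) :
    dist (c.ray s) (c.ray t) = |(s : ℝ) - t| := by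
  rw [c.isometry_ray.dist_eq, NNReal.dist_eq]

theorem dist_base_ray {X : Type*} [MetricSpace X] {x : X} (c : VisualBoundary x) (t : ℝ≥0) :
    dist x (c.ray t) = t := by
  have := c.dist_ray 0 t
  rwa [c.ray_zero, NNReal.coe_zero, zero_sub, abs_neg, abs_of_nonneg t.coe_nonneg] at this

theorem btw_ray {X : Type*} [MetricSpace X] {x : X} (c : VisualBoundary x) {r s t : ℝ≥0}
    (hrs : r ≤ s) (hst : s ≤ t) : MetricBtw (c.ray r) (c.ray s) (c.ray t) := by
  have h1 : (r : ℝ) ≤ s := hrs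
  have h2 : (s : ℝ) ≤ t := hst
  unfold MetricBtw
  rw [dist_ray, dist_ray, dist_ray, abs_of_nonpos (by linarith), abs_of_nonpos (by linarith),
    abs_of_nonpos (by linarith)]
  ring

theorem gpt_ray {X : Type*} [MetricSpace X] (hX : IsCAT0 X) {x : X} (c : VisualBoundary x)
    {s t : ℝ≥0} (h : s ≤ t) : gpt x (c.ray t) s = c.ray s := by
  have h' : (s : ℝ) ≤ t := h
  refine (hX.eq_gpt (c.dist_base_ray s) ?_).symm
  rw [dist_ray, dist_base_ray, abs_of_nonpos (by linarith)]; ring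

theorem mul_dist_ray_le {X : Type*} [MetricSpace X] (hX : IsCAT0 X) {x : X}
    (c c' : VisualBoundary x) {s t : ℝ≥0} (h : s ≤ t) :
    t * dist (c.ray s) (c'.ray s) ≤ s * dist (c.ray t) (c'.ray t) := by
  have h' : (s : ℝ) ≤ t := h
  rcases eq_or_lt_of_le (show (0 : ℝ) ≤ t from t.coe_nonneg) with ht | ht
  · obtain rfl : t = 0 := by ext; exact ht.symm
    simp [le_antisymm h zero_le]
  · rw [← c.gpt_ray hX h, ← c'.gpt_ray hX h]
    unfold gpt
    rw [dist_base_ray, dist_base_ray]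
    have := hX.dist_seg_right x (c.ray t) (c'.ray t) (l := s / t) (by positivity)
      (div_le_one_of_le₀ h' t.coe_nonneg)
    calc _ ≤ (t : ℝ) * (s / t * dist (c.ray t) (c'.ray t)) := by gcongr
      _ = _ := by field_simp

theorem eq_of_dist_ray_le {X : Type*} [MetricSpace X] (hX : IsCAT0 X) {x : X}
    {c c' : VisualBoundary x} {K : ℝ} (h : ∀ t, dist (c.ray t) (c'.ray t) ≤ K) : c = c' := by
  ext s
  by_contra hne
  have hpos : 0 < dist (c.ray s) (c'.ray s) := dist_pos.2 hne
  have hK : 0 ≤ K := dist_nonneg.trans (h 0)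
  -- A time at which linear divergence would exceed `K`.
  set t : ℝ≥0 := s + ⟨s * K / dist (c.ray s) (c'.ray s) + 1, by positivity⟩ with ht
  have h1 := c.mul_dist_ray_le hX c' (s := s) (t := t) (by rw [ht]; exact le_self_add)
  have h2 : (s : ℝ) * dist (c.ray t) (c'.ray t) ≤ s * K := by gcongr; exact h t
  have h3 : (t : ℝ) = s + (s * K / dist (c.ray s) (c'.ray s) + 1) := by rw [ht]; rfl
  have h4 : (t : ℝ) * dist (c.ray s) (c'.ray s) =
      s * dist (c.ray s) (c'.ray s) + s * K + dist (c.ray s) (c'.ray s) := by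
    rw [h3]; field_simp; ring
  have h5 : 0 ≤ (s : ℝ) * dist (c.ray s) (c'.ray s) := by positivity
  linarith

/-- The cone topology is pointwise convergence, so continuity can be tested at each time. Basic sets
only control positive times, but at time `0` all rays agree. -/
theorem isInducing_ray {X : Type*} [MetricSpace X] (x : X) :
    IsInducing (ray : VisualBoundary x → ℝ≥0 → X) := by
  refine ⟨le_antisymm ?_ ?_⟩
  · rw [← continuous_iff_le_induced, continuous_pi_iff]
    intro r
    rw [continuous_iff_continuousAt]
    intro c
    rcases eq_or_lt_of_le (zero_le (a := r)) with rfl | hr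
    · simp only [ray_zero]; exact continuousAt_const
    · refine Metric.tendsto_nhds.2 fun D hD => ?_
      have : IsOpen (basicNhd c r D) :=
        TopologicalSpace.isOpen_generateFrom_of_mem ⟨c, r, D, hr, hD, rfl⟩
      filter_upwards [this.mem_nhds (show c ∈ basicNhd c r D by simp [basicNhd, hD])] with c' hc'
      rw [dist_comm]; exact hc'
  · refine le_generateFrom ?_
    rintro _ ⟨c, r, D, -, -, rfl⟩
    refine ⟨{f | dist (c.ray r) (f r) < D}, ?_, rfl⟩
    exact isOpen_lt (by fun_prop) continuous_const

theorem continuous_iff {X : Type*} [MetricSpace X] {x : X} {Y : Type*} [TopologicalSpace Y]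
    {f : Y → VisualBoundary x} : Continuous f ↔ ∀ r, Continuous fun y => (f y).ray r := by
  rw [(isInducing_ray x).continuous_iff, continuous_pi_iff]; rfl

theorem tendsto_smallSets {X : Type*} [MetricSpace X] {x : X} {ι : Type*} {l : Filter ι}
    {P : ι → Set (VisualBoundary x)} {a : VisualBoundary x}
    (h : ∀ r : ℝ≥0, ∀ δ > 0, ∀ᶠ i in l, ∀ c ∈ P i, dist (a.ray r) (c.ray r) ≤ δ) :
    Tendsto P l (𝓝 a).smallSets := by
  rw [TopologicalSpace.nhds_generateFrom]
  simp only [smallSets_iInf, smallSets_principal, tendsto_iInf, tendsto_principal]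
  rintro _ ⟨ha, c, r, D, -, -, rfl⟩
  have ha' : dist (c.ray r) (a.ray r) < D := ha
  filter_upwards [h r ((D - dist (c.ray r) (a.ray r)) / 2) (by linarith)] with i hi c' hc'
  have h1 := hi c' hc'
  have h2 := dist_triangle (c.ray r) (a.ray r) (c'.ray r)
  change dist (c.ray r) (c'.ray r) < D
  linarith

/-- Geodesic segments from `x` to points that go to infinity accumulate at geodesic rays. -/
theorem exists_limit {X : Type*} [MetricSpace X] [ProperSpace X] (hX : IsCAT0 X) (x : X)
    {ι : Type*} (U : Ultrafilter ι) (q : ι → X)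
    (hq : Tendsto (fun i => dist x (q i)) U atTop) :
    ∃ c : VisualBoundary x, ∀ r : ℝ≥0, Tendsto (fun i => gpt x (q i) r) U (𝓝 (c.ray r)) := by
  have h1 : ∀ r : ℝ≥0, ∃ z, Tendsto (fun i => gpt x (q i) r) U (𝓝 z) := by
    intro r
    have hev : ∀ᶠ i in (U : Filter ι), gpt x (q i) r ∈ Metric.closedBall x r := by
      filter_upwards [hq.eventually_ge_atTop (r : ℝ)] with i hi
      rw [Metric.mem_closedBall, dist_comm, (hX.gpt_spec x (q i) r.coe_nonneg hi).1]
    -- The ultrafilter provides limits for all `r` at once, replacing a diagonal subsequence.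
    obtain ⟨z, -, hz⟩ := (isCompact_closedBall x (r : ℝ)).ultrafilter_le_nhds
      (U.map fun i => gpt x (q i) r) (by rw [Ultrafilter.coe_map]; exact tendsto_principal.2 hev)
    exact ⟨z, hz⟩
  choose z hz using h1
  refine ⟨⟨z, ?_, ?_⟩, hz⟩
  · refine Isometry.of_dist_eq fun r s => ?_
    refine tendsto_nhds_unique ((hz r).dist (hz s)) ?_
    refine tendsto_const_nhds.congr' ?_
    filter_upwards [hq.eventually_ge_atTop (r : ℝ), hq.eventually_ge_atTop (s : ℝ)] with i hi hj
    rw [hX.dist_gpt_gpt x (q i) r.coe_nonneg hi s.coe_nonneg hj, NNReal.dist_eq]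
  · refine tendsto_nhds_unique (hz 0) ?_
    refine tendsto_const_nhds.congr' ?_
    filter_upwards [hq.eventually_ge_atTop (0 : ℝ)] with i hi
    have := (hX.gpt_spec x (q i) le_rfl hi).1
    rw [NNReal.coe_zero]
    exact dist_eq_zero.1 this

theorem tendsto_dist_ray_nat {X : Type*} [MetricSpace X] {x : X} (c : VisualBoundary x) (y : X) :
    Tendsto (fun n : ℕ => dist y (c.ray n)) atTop atTop := by
  refine tendsto_atTop_mono (f := fun n : ℕ => (n : ℝ) - dist x y) (fun n => ?_)
    (tendsto_atTop_add_const_right _ _ tendsto_natCast_atTop_atTop)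
  have := dist_triangle x y (c.ray n)
  rw [c.dist_base_ray, NNReal.coe_natCast] at this
  linarith

theorem exists_rebase {X : Type*} [MetricSpace X] [ProperSpace X] (hX : IsCAT0 X) {x : X}
    (c : VisualBoundary x) (y : X) : ∃ c' : VisualBoundary y,
      ∀ r : ℝ≥0, Tendsto (fun n : ℕ => gpt y (c.ray n) r) (hyperfilter ℕ) (𝓝 (c'.ray r)) :=
  exists_limit hX y (hyperfilter ℕ) (fun n => c.ray n)
    ((c.tendsto_dist_ray_nat y).mono_left Nat.hyperfilter_le_atTop)

/-- The ray from `y` asymptotic to the ray `c`. -/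
noncomputable def rebase {X : Type*} [MetricSpace X] [ProperSpace X] (hX : IsCAT0 X) {x : X}
    (c : VisualBoundary x) (y : X) : VisualBoundary y := (c.exists_rebase hX y).choose

theorem tendsto_rebase {X : Type*} [MetricSpace X] [ProperSpace X] (hX : IsCAT0 X) {x : X}
    (c : VisualBoundary x) (y : X) (r : ℝ≥0) :
    Tendsto (fun n : ℕ => gpt y (c.ray n) r) (hyperfilter ℕ) (𝓝 ((c.rebase hX y).ray r)) :=
  (c.exists_rebase hX y).choose_spec r

theorem rebase_mem {X : Type*} [MetricSpace X] [ProperSpace X] (hX : IsCAT0 X) {x : X}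
    (c : VisualBoundary x) {y : X} {C : Set X} (hC : IsClosed C) (hC' : GeodConvex C)
    (hy : y ∈ C) (hc : ∀ t, c.ray t ∈ C) (t : ℝ≥0) : (c.rebase hX y).ray t ∈ C := by
  refine hC.mem_of_tendsto (c.tendsto_rebase hX y t) ?_
  filter_upwards [((c.tendsto_dist_ray_nat y).mono_left
    Nat.hyperfilter_le_atTop).eventually_ge_atTop (t : ℝ)] with n hn
  exact hX.gpt_mem hC' hy (hc n) t.coe_nonneg hn

/-- Compare the segments from `x` and `y` to a far point of `c`. Equal proportions cost at most
`dist x y`; passing from equal proportions to equal distances costs at most as much again. -/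
theorem dist_rebase_le {X : Type*} [MetricSpace X] [ProperSpace X] (hX : IsCAT0 X) {x : X}
    (c : VisualBoundary x) (y : X) (t : ℝ≥0) :
    dist ((c.rebase hX y).ray t) (c.ray t) ≤ 2 * dist x y := by
  refine le_of_tendsto ((c.tendsto_rebase hX y t).dist tendsto_const_nhds) ?_
  filter_upwards [((c.tendsto_dist_ray_nat y).mono_left
    Nat.hyperfilter_le_atTop).eventually_ge_atTop (t : ℝ),
    (tendsto_natCast_atTop_atTop (R := ℝ).mono_left
    Nat.hyperfilter_le_atTop).eventually_ge_atTop (t : ℝ),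
    (tendsto_natCast_atTop_atTop (R := ℝ).mono_left
    Nat.hyperfilter_le_atTop).eventually_gt_atTop 0] with n h1 h2 h3
  have h2' : t ≤ (n : ℝ≥0) := by exact_mod_cast h2
  rw [← c.gpt_ray hX h2']
  have hxn : dist x (c.ray n) = n := by rw [c.dist_base_ray, NNReal.coe_natCast]
  set q := c.ray n
  rcases eq_or_lt_of_le (dist_nonneg (x := y) (y := q)) with hd | hd
  · have ht : (t : ℝ) = 0 := le_antisymm (hd ▸ h1) t.coe_nonneg
    rw [ht]
    have e1 := (hX.gpt_spec y q le_rfl dist_nonneg).1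
    have e2 := (hX.gpt_spec x q le_rfl dist_nonneg).1
    rw [← dist_eq_zero.1 e1, ← dist_eq_zero.1 e2, dist_comm]
    linarith [dist_nonneg (x := x) (y := y)]
  have a := hX.dist_seg_left y x q (l := t / dist y q) (by positivity)
    (div_le_one_of_le₀ h1 dist_nonneg)
  have b := hX.dist_seg_seg x q (l := t / dist y q) (m := t / dist x q) (by positivity)
    (div_le_one_of_le₀ h1 dist_nonneg) (by positivity)
    (div_le_one_of_le₀ (by rw [hxn]; exact h2) dist_nonneg)
  have hx : 0 < dist x q := by rw [hxn]; exact h3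
  have d : |t / dist y q - t / dist x q| * dist x q ≤ t / dist y q * dist x y := by
    have e : t / dist y q - t / dist x q = t / dist y q / dist x q * (dist x q - dist y q) := by
      field_simp
    rw [e, abs_mul, abs_of_nonneg (a := t / dist y q / dist x q) (by positivity)]
    calc _ = t / dist y q * |dist x q - dist y q| := by field_simp
      _ ≤ _ := by gcongr; exact abs_dist_sub_le x y q
  have e : t / dist y q * dist x y ≤ dist x y :=
    mul_le_of_le_one_left dist_nonneg (div_le_one_of_le₀ h1 dist_nonneg)
  have f : (1 - t / dist y q) * dist y x ≤ dist x y := by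
    rw [dist_comm y x]
    exact mul_le_of_le_one_left dist_nonneg (by linarith [show 0 ≤ t / dist y q by positivity])
  have g := dist_triangle (gpt y q t) (seg x q (t / dist y q)) (gpt x q t)
  unfold gpt at g ⊢
  linarith

/-- Rays from one point at bounded distance coincide, so asymptoticity characterizes `rebase`. This
makes change of base point functorial, although it was built from an ultrafilter. -/
theorem eq_rebase {X : Type*} [MetricSpace X] [ProperSpace X] (hX : IsCAT0 X) {x y : X}
    {c : VisualBoundary x} {c' : VisualBoundary y} {K : ℝ}
    (h : ∀ t, dist (c'.ray t) (c.ray t) ≤ K) : c' = c.rebase hX y := by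
  refine eq_of_dist_ray_le hX (K := K + 2 * dist x y) fun t => ?_
  have h1 := h t
  have h2 := c.dist_rebase_le hX y t
  have h3 := dist_triangle_right (c'.ray t) ((c.rebase hX y).ray t) (c.ray t)
  linarith

theorem rebase_rebase {X : Type*} [MetricSpace X] [ProperSpace X] (hX : IsCAT0 X) {x : X}
    (c : VisualBoundary x) (y z : X) : (c.rebase hX y).rebase hX z = c.rebase hX z := by
  refine eq_rebase hX (K := 2 * dist y z + 2 * dist x y) fun t => ?_
  have h1 := (c.rebase hX y).dist_rebase_le hX z t
  have h2 := c.dist_rebase_le hX y t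
  have h3 := dist_triangle (((c.rebase hX y).rebase hX z).ray t) ((c.rebase hX y).ray t) (c.ray t)
  linarith

theorem rebase_self {X : Type*} [MetricSpace X] [ProperSpace X] (hX : IsCAT0 X) {x : X}
    (c : VisualBoundary x) : c.rebase hX x = c :=
  (eq_rebase hX (K := 0) fun t => by simp).symm

/-- A family of rays is continuous if nearby rays of the family stay at bounded distance for a
long time. -/
theorem continuous_of_dist_ray_le {X : Type*} [MetricSpace X] (hX : IsCAT0 X) {x : X}
    {Y : Type*} [TopologicalSpace Y] {f : Y → VisualBoundary x} (K : ℝ)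
    (h : ∀ (y : Y) (T : ℝ≥0), ∀ᶠ z in 𝓝 y, dist ((f z).ray T) ((f y).ray T) ≤ K) :
    Continuous f := by
  rw [continuous_iff]
  intro r
  rw [continuous_iff_continuousAt]
  intro y
  refine Metric.tendsto_nhds.2 fun D hD => ?_
  have hK : 0 ≤ K := by
    obtain ⟨z, hz⟩ := (h y 0).exists
    exact dist_nonneg.trans hz
  set T : ℝ≥0 := r + ⟨r * K / D + 1, by positivity⟩ with hT
  have hT' : (T : ℝ) = r + (r * K / D + 1) := by rw [hT]; rfl
  have hT0 : (0 : ℝ) < T := by rw [hT']; positivity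
  filter_upwards [h y T] with z hz
  have h1 := (f z).mul_dist_ray_le hX (f y) (s := r) (t := T) (by rw [hT]; exact le_self_add)
  have h2 : (r : ℝ) * dist ((f z).ray T) ((f y).ray T) ≤ r * K := by gcongr
  have h3 : r * K < T * D := by
    have : (T : ℝ) * D = r * D + r * K + D := by rw [hT']; field_simp; ring
    have h5 : 0 ≤ (r : ℝ) * D := by positivity
    linarith
  exact lt_of_mul_lt_mul_left ((h1.trans h2).trans_lt h3) hT0.le

theorem continuous_rebase {X : Type*} [MetricSpace X] [ProperSpace X] (hX : IsCAT0 X) (x y : X) :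
    Continuous fun c : VisualBoundary x => c.rebase hX y := by
  refine continuous_of_dist_ray_le hX (2 * dist x y + 1 + 2 * dist x y) fun c T => ?_
  have := (continuous_iff.1 (continuous_id (X := VisualBoundary x)) T).tendsto c
  filter_upwards [Metric.tendsto_nhds.1 this 1 one_pos] with c' hc'
  have h1 := c.dist_rebase_le hX y T
  have h2 := c'.dist_rebase_le hX y T
  have h3 := dist_triangle4 ((c'.rebase hX y).ray T) (c'.ray T) (c.ray T) ((c.rebase hX y).ray T)
  rw [dist_comm (c.ray T)] at h3
  simp only [id] at hc'
  linarith

/-- A ray of a subspace, as a ray of the ambient space. -/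
def incl {X : Type*} [MetricSpace X] {B : Set X} {b : B} (c : VisualBoundary b) :
    VisualBoundary (b : X) where
  ray t := c.ray t
  isometry_ray := isometry_subtype_coe.comp c.isometry_ray
  ray_zero := by rw [c.ray_zero]

theorem continuous_incl {X : Type*} [MetricSpace X] {B : Set X} (b : B) :
    Continuous (incl : VisualBoundary b → VisualBoundary (b : X)) := by
  rw [continuous_iff]
  intro r
  exact continuous_subtype_val.comp (continuous_iff.1 continuous_id r)

/-- Two rays whose Tits angle is smaller than `π` can be joined by a path. -/
theorem joined_of_dist_ray_le {X : Type*} [MetricSpace X] [ProperSpace X] (hX : IsCAT0 X) {x : X}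
    (a b : VisualBoundary x) {k : ℝ} (hk : k < 2) (r₀ : ℝ≥0)
    (h : ∀ t, r₀ ≤ t → dist (a.ray t) (b.ray t) ≤ k * t) : Joined a b := by
  set η : ℝ := (2 - k) / 2 with hη
  have hη0 : 0 < η := by rw [hη]; linarith
  -- By the triangle inequality through a point `z` of the chord, `2 n ≤ 2 dist x z + k n`. So the
  -- chords between the rays escape to infinity linearly, and their radial projections have limits
  -- that are Lipschitz in `l`.
  have hpt : ∀ n : ℕ, r₀ ≤ n → ∀ l ∈ Set.Icc (0 : ℝ) 1,
      η * n ≤ dist x (seg (a.ray n) (b.ray n) l) := by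
    intro n hn l hl
    have e := hX.btw_seg (a.ray n) (b.ray n) hl.1 hl.2
    have h1 := dist_triangle_right x (a.ray n) (seg (a.ray n) (b.ray n) l)
    have h2 := dist_triangle x (seg (a.ray n) (b.ray n) l) (b.ray n)
    have h3 := h n hn
    unfold MetricBtw at e
    rw [dist_base_ray, NNReal.coe_natCast] at h1 h2
    rw [NNReal.coe_natCast] at h3
    rw [hη]
    linarith
  have hevn : ∀ T : ℝ≥0, ∀ᶠ n : ℕ in (hyperfilter ℕ : Filter ℕ), T ≤ n := fun T =>
    (tendsto_natCast_atTop_atTop (R := ℝ≥0).mono_left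
      Nat.hyperfilter_le_atTop).eventually_ge_atTop T
  have hlim : ∀ l : Set.Icc (0 : ℝ) 1, ∃ c : VisualBoundary x, ∀ r : ℝ≥0,
      Tendsto (fun n : ℕ => gpt x (seg (a.ray n) (b.ray n) l) r) (hyperfilter ℕ)
        (𝓝 (c.ray r)) := by
    intro l
    refine exists_limit hX x (hyperfilter ℕ) _ ?_
    refine tendsto_atTop_mono' (f₁ := fun n : ℕ => η * n) _ ?_
      (((tendsto_natCast_atTop_atTop (R := ℝ)).mono_left
        Nat.hyperfilter_le_atTop).const_mul_atTop hη0)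
    filter_upwards [hevn r₀] with n hn
    exact hpt n hn l l.2
  choose c hc using hlim
  have hlip : ∀ l m : Set.Icc (0 : ℝ) 1, ∀ r : ℝ≥0,
      dist ((c l).ray r) ((c m).ray r) ≤ 4 * r / η * dist l m := by
    intro l m r
    rcases eq_or_lt_of_le (zero_le (a := r)) with rfl | hr
    · simp [ray_zero]
    have hr' : (0 : ℝ) < r := hr
    refine le_of_tendsto ((hc l r).dist (hc m r)) ?_
    filter_upwards [hevn r₀, hevn (⟨r / η, by positivity⟩), hevn r] with n hn hn' hnr
    have hn2 : r / η ≤ (n : ℝ) := by exact_mod_cast hn'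
    have hn3 : r ≤ η * (n : ℝ) := by rwa [div_le_iff₀' hη0] at hn2
    have hn4 : (0 : ℝ) < n := hr'.trans_le (by exact_mod_cast hnr)
    have e1 := hpt n hn l l.2
    have e2 := hpt n hn m m.2
    refine (hX.dist_gpt_le x _ _ hr' (hn3.trans e1) (hn3.trans e2)).trans ?_
    rw [hX.dist_seg_seg _ _ l.2.1 l.2.2 m.2.1 m.2.2]
    have e3 : dist (a.ray n) (b.ray n) ≤ 2 * n := by
      have := dist_triangle_left (a.ray n) (b.ray n) x
      rw [dist_base_ray, dist_base_ray, NNReal.coe_natCast] at this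
      linarith
    have e4 : |(l : ℝ) - m| = dist l m := rfl
    rw [e4]
    calc _ ≤ 2 * r * (dist l m * (2 * n)) / (η * n) := by gcongr
      _ = _ := by field_simp; ring
  have hcont : Continuous c := by
    rw [continuous_iff]
    intro r
    refine (LipschitzWith.of_dist_le_mul (K := ⟨4 * r / η, by positivity⟩) fun l m => ?_).continuous
    exact hlip l m r
  have h0 : c 0 = a := by
    ext r
    refine tendsto_nhds_unique (hc 0 r) (tendsto_const_nhds.congr' ?_)
    filter_upwards [hevn r] with n hn
    rw [Set.Icc.coe_zero, hX.seg_zero, a.gpt_ray hX hn]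
  have h1 : c 1 = b := by
    ext r
    refine tendsto_nhds_unique (hc 1 r) (tendsto_const_nhds.congr' ?_)
    filter_upwards [hevn r] with n hn
    rw [Set.Icc.coe_one, hX.seg_one, b.gpt_ray hX hn]
  exact ⟨⟨⟨c, hcont⟩, h0, h1⟩⟩

end VisualBoundary

/-! ### Infinite concatenation of paths -/

/-- The concatenation of infinitely many paths that shrink to a point. -/
theorem joined_of_joinedIn_of_tendsto {Y : Type*} [TopologicalSpace Y] {P : ℕ → Set Y} {a : ℕ → Y}
    {y : Y} (hj : ∀ n, JoinedIn (P n) (a n) (a (n + 1))) (hP : Tendsto P atTop (𝓝 y).smallSets) :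
    Joined (a 0) y := by
  choose γ hγ using hj
  set F : ℝ → Y := fun t => (γ ⌊t⌋₊).extend (t - ⌊t⌋₊) with hF
  have hFn : ∀ n : ℕ, ∀ t ∈ Set.Icc (n : ℝ) (n + 1), F t = (γ n).extend (t - n) := by
    intro n t ht
    rcases eq_or_lt_of_le ht.2 with h | h
    · have : ⌊t⌋₊ = n + 1 := by rw [h]; exact_mod_cast Nat.floor_natCast (n + 1)
      simp only [hF]
      rw [this, h]
      simp
    · have : ⌊t⌋₊ = n := by rw [Nat.floor_eq_iff ((Nat.cast_nonneg n).trans ht.1)]; exact ⟨ht.1, h⟩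
      simp only [hF]
      rw [this]
  have hF0 : ∀ t ≤ (0 : ℝ), F t = a 0 := by
    intro t ht
    simp only [hF]
    rw [Nat.floor_of_nonpos ht, Path.extend_of_le_zero _ (by simpa using ht)]
  have hFc : ∀ n : ℕ, ContinuousOn F (Set.Iic (n : ℝ)) := by
    intro n
    induction n with
    | zero =>
      refine (continuousOn_const (c := a 0)).congr fun t ht => hF0 t ?_
      simpa using ht
    | succ n ih =>
      have h2 : ContinuousOn F (Set.Icc (n : ℝ) (n + 1)) := by
        refine ContinuousOn.congr (f := fun t => (γ n).extend (t - n)) ?_ (hFn n)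
        exact ((γ n).continuous_extend.comp (by fun_prop)).continuousOn
      have h3 := ih.union_of_isClosed h2 isClosed_Iic isClosed_Icc
      rw [Set.Iic_union_Icc_eq_Iic (by linarith)] at h3
      rwa [Nat.cast_succ]
  have hFcont : Continuous F := by
    rw [continuous_iff_continuousAt]
    intro t
    obtain ⟨n, hn⟩ := exists_nat_gt t
    exact (hFc n).continuousAt (Iic_mem_nhds hn)
  have hFP : ∀ t : ℝ, F t ∈ P ⌊t⌋₊ := by
    intro t
    simp only [hF]
    have := (γ ⌊t⌋₊).extend_range
    have h2 : (γ ⌊t⌋₊).extend (t - ⌊t⌋₊) ∈ Set.range (γ ⌊t⌋₊).extend := ⟨_, rfl⟩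
    rw [this] at h2
    obtain ⟨s, hs⟩ := h2
    rw [← hs]
    exact hγ _ s
  -- The half-line is compressed to `[0, 1)`; continuity at `1` is the shrinking of the sets `P n`.
  set G : ℝ → Y := fun s => if s < 1 then F ((1 - s)⁻¹ - 1) else y with hG
  have hGc : Continuous G := by
    rw [continuous_iff_continuousAt]
    intro s
    rcases lt_trichotomy s 1 with h | h | h
    · have : ContinuousAt (fun s : ℝ => F ((1 - s)⁻¹ - 1)) s := by
        refine hFcont.continuousAt.comp ?_
        have : 1 - s ≠ 0 := by linarith
        fun_prop (disch := assumption)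
      refine this.congr ?_
      filter_upwards [Iio_mem_nhds h] with u hu
      simp only [hG]
      rw [if_pos (show u < 1 from hu)]
    · subst h
      have hG1 : G 1 = y := by simp [hG]
      rw [ContinuousAt, hG1]
      intro U hU
      obtain ⟨N, hN⟩ := eventually_atTop.1 (tendsto_smallSets_iff.1 hP U hU)
      have hlt : 1 - ((N : ℝ) + 1)⁻¹ < 1 := by
        have : (0 : ℝ) < ((N : ℝ) + 1)⁻¹ := by positivity
        linarith
      rw [mem_map]
      filter_upwards [Ioi_mem_nhds hlt] with u hu
      have hu' : 1 - u < ((N : ℝ) + 1)⁻¹ := by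
        have : 1 - ((N : ℝ) + 1)⁻¹ < u := hu
        linarith
      simp only [hG, Set.mem_preimage]
      split_ifs with hu1
      · refine hN _ ?_ (hFP _)
        refine Nat.le_floor ?_
        have := (lt_inv_comm₀ (by linarith) (by positivity)).1 hu'
        linarith
      · exact mem_of_mem_nhds hU
    · refine (continuousAt_const (y := y)).congr ?_
      filter_upwards [Ioi_mem_nhds h] with u hu
      simp only [hG]
      rw [if_neg (not_lt.2 (le_of_lt hu))]
  refine ⟨⟨⟨fun t => G t, hGc.comp continuous_subtype_val⟩, ?_, ?_⟩⟩
  · simp [hG, hF0 0 le_rfl]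
  · simp [hG]

/-! ### Projections, and separation by walls -/

theorem IsCAT0.exists_projection {X : Type*} [MetricSpace X] [ProperSpace X] (hX : IsCAT0 X)
    {C : Set X} (hC : IsClosed C) (hC' : GeodConvex C) (hne : C.Nonempty) :
    ∃ π : X → X, Continuous π ∧ ∀ x, π x ∈ C ∧ Metric.infDist x C = dist x (π x) := by
  choose π hπ hd using fun x => hC.exists_infDist_eq_dist hne x
  refine ⟨π, ?_, fun x => ⟨hπ x, hd x⟩⟩
  -- The midpoint of the two projections is no closer to `x` than the set is; the Bruhat–Tits
  -- inequality then bounds their distance.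
  have key : ∀ x y,
      dist (π x) (π y) ^ 2 ≤ 8 * Metric.infDist x C * dist x y + 8 * dist x y ^ 2 := by
    intro x y
    have h1 := hX.dist_sq_seg_le x (π x) (π y) (l := 1 / 2) (by norm_num) (by norm_num)
    have h2 : Metric.infDist x C ≤ dist x (seg (π x) (π y) (1 / 2)) :=
      Metric.infDist_le_dist_of_mem (hX.seg_mem hC' (hπ x) (hπ y) (by norm_num) (by norm_num))
    have h3 : dist x (π y) ≤ Metric.infDist x C + 2 * dist x y := by
      have a1 := dist_triangle x y (π y)
      have a2 : Metric.infDist y C ≤ Metric.infDist x C + dist y x :=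
        Metric.infDist_le_infDist_add_dist
      rw [← hd y] at a1
      rw [dist_comm y x] at a2
      linarith
    rw [← hd x] at h1
    have h4 : Metric.infDist x C ^ 2 ≤ dist x (seg (π x) (π y) (1 / 2)) ^ 2 := by
      gcongr; exact Metric.infDist_nonneg
    have h5 : dist x (π y) ^ 2 ≤ (Metric.infDist x C + 2 * dist x y) ^ 2 := by gcongr
    nlinarith
  rw [continuous_iff_continuousAt]
  intro x
  rw [ContinuousAt, tendsto_iff_dist_tendsto_zero]
  have hlim : Tendsto (fun y => √(8 * Metric.infDist x C * dist x y + 8 * dist x y ^ 2)) (𝓝 x)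
      (𝓝 0) := by
    have : Continuous fun y => √(8 * Metric.infDist x C * dist x y + 8 * dist x y ^ 2) := by
      fun_prop
    simpa using this.tendsto x
  refine squeeze_zero (fun _ => dist_nonneg) (fun y => ?_) hlim
  rw [dist_comm]
  exact Real.le_sqrt_of_sq_le (key x y)

/-- At the scale `ε`, at most two blocks are visible from any point, and they intersect. -/
structure IsSeparationRadius {X : Type*} [MetricSpace X] (𝓑 : Set (Set X)) (ε : ℝ) : Prop where
  pos : 0 < ε
  inter : ∀ x, ∀ B ∈ 𝓑, ∀ B' ∈ 𝓑, (B ∩ Metric.ball x ε).Nonempty →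
    (B' ∩ Metric.ball x ε).Nonempty → (B ∩ B').Nonempty
  two : ∀ x, ∀ B ∈ 𝓑, ∀ B' ∈ 𝓑, ∀ B'' ∈ 𝓑, (B ∩ Metric.ball x ε).Nonempty →
    (B' ∩ Metric.ball x ε).Nonempty → (B'' ∩ Metric.ball x ε).Nonempty → B ≠ B' →
    B'' = B ∨ B'' = B'

theorem IsBlockDecomposition.exists_separationRadius {X : Type*} [MetricSpace X]
    {𝓑 : Set (Set X)} (h𝓑 : IsBlockDecomposition 𝓑) : ∃ ε, IsSeparationRadius 𝓑 ε := by
  obtain ⟨ε, hε, h⟩ := h𝓑.epsilon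
  obtain ⟨σ, hσ⟩ := h𝓑.parity
  have hi : ∀ x, ∀ B ∈ 𝓑, ∀ B' ∈ 𝓑, (B ∩ Metric.ball x ε).Nonempty →
      (B' ∩ Metric.ball x ε).Nonempty → (B ∩ B').Nonempty := by
    rintro x B hB B' hB' ⟨y, hy, hyx⟩ ⟨z, hz, hzx⟩
    refine (h B hB B' hB').2 ⟨x, ?_, ?_⟩
    · exact Metric.mem_thickening_iff.2 ⟨y, hy, by rw [dist_comm]; exact hyx⟩
    · exact Metric.mem_thickening_iff.2 ⟨z, hz, by rw [dist_comm]; exact hzx⟩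
  refine ⟨ε, hε, hi, ?_⟩
  intro x B hB B' hB' B'' hB'' h1 h2 h3 hne
  by_contra! hcon
  have e1 := hσ B hB B' hB' hne (hi x B hB B' hB' h1 h2)
  have e2 := hσ B'' hB'' B hB hcon.1 (hi x B'' hB'' B hB h3 h1)
  have e3 := hσ B'' hB'' B' hB' hcon.2 (hi x B'' hB'' B' hB' h3 h2)
  -- Three pairwise intersecting distinct blocks would need three parities.
  cases h1 : σ B <;> cases h2 : σ B' <;> cases h3 : σ B'' <;> simp_all

theorem IsSeparationRadius.nonempty_inter_ball {X : Type*} [MetricSpace X] {𝓑 : Set (Set X)}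
    {ε : ℝ} (hε : IsSeparationRadius 𝓑 ε) {B : Set X} {x : X} (hx : x ∈ B) :
    (B ∩ Metric.ball x ε).Nonempty := ⟨x, hx, Metric.mem_ball_self hε.pos⟩

theorem IsSeparationRadius.eq_or_eq {X : Type*} [MetricSpace X] {𝓑 : Set (Set X)} {ε : ℝ}
    (hε : IsSeparationRadius 𝓑 ε) {B B' B'' : Set X} (hB : B ∈ 𝓑) (hB' : B' ∈ 𝓑)
    (hB'' : B'' ∈ 𝓑) (hne : B ≠ B') {x y : X} (hx : x ∈ B ∩ B') (hy : y ∈ B'')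
    (hxy : dist y x < ε) : B'' = B ∨ B'' = B' :=
  hε.two x B hB B' hB' B'' hB'' (hε.nonempty_inter_ball hx.1) (hε.nonempty_inter_ball hx.2)
    ⟨y, hy, hxy⟩ hne

theorem IsBlockDecomposition.exists_mem {X : Type*} [MetricSpace X]
    {𝓑 : Set (Set X)} (h𝓑 : IsBlockDecomposition 𝓑) (x : X) : ∃ B ∈ 𝓑, x ∈ B := by
  have : x ∈ ⋃₀ 𝓑 := by rw [h𝓑.cover]; trivial
  exact this

theorem GeodConvex.inter {X : Type*} [MetricSpace X] {C D : Set X} (hC : GeodConvex C)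
    (hD : GeodConvex D) : GeodConvex (C ∩ D) :=
  fun x hx y hy z hz => ⟨hC x hx.1 y hy.1 z hz, hD x hx.2 y hy.2 z hz⟩

/-- A wall separates the two blocks that meet in it. -/
theorem IsBlockDecomposition.exists_sides {X : Type*} [MetricSpace X] [ProperSpace X]
    (hX : IsCAT0 X) {𝓑 : Set (Set X)} (h𝓑 : IsBlockDecomposition 𝓑) {B B' : Set X} (hB : B ∈ 𝓑)
    (hB' : B' ∈ 𝓑) (hne : B ≠ B') (hW : (B ∩ B').Nonempty) :
    ∃ N F : Set X, IsClosed N ∧ IsClosed F ∧ N ∪ F = Set.univ ∧ N ∩ F = B ∩ B' ∧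
      B ⊆ N ∧ B' ⊆ F := by
  obtain ⟨ε, hε⟩ := h𝓑.exists_separationRadius
  have hWc : GeodConvex (B ∩ B') := (h𝓑.convex B hB).inter (h𝓑.convex B' hB')
  obtain ⟨π, hπ, hπd⟩ := hX.exists_projection ((h𝓑.isClosed B hB).inter (h𝓑.isClosed B' hB'))
    hWc hW
  set δ : ℝ := min ε 1 / 2 with hδ
  have hmin : 0 < min ε 1 := lt_min hε.pos one_pos
  have hδ0 : 0 < δ := by positivity
  have hδ1 : δ < 1 := by rw [hδ]; linarith [min_le_right ε 1]
  have hδε : δ < ε := by rw [hδ]; linarith [min_le_left ε 1]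
  set l : X → ℝ := fun x => δ / (1 + dist x (π x)) with hl
  have hl0 : ∀ x, 0 < l x := fun x => by simp only [hl]; positivity
  have hl1 : ∀ x, l x < 1 := fun x => by
    simp only [hl]; rw [div_lt_one (by positivity)]; linarith [dist_nonneg (x := x) (y := π x)]
  have hlc : Continuous l := by
    have : ∀ x, 1 + dist x (π x) ≠ 0 := fun x => by positivity
    fun_prop (disch := assumption)
  have hld : ∀ x, l x * dist x (π x) < ε := fun x => by
    refine lt_of_le_of_lt ?_ hδε
    simp only [hl]
    rw [div_mul_eq_mul_div, div_le_iff₀ (by positivity)]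
    linarith
  -- Each `x` is pulled along the segment to its projection until it is within `ε` of the wall,
  -- where only `B` and `B'` are present; the side of `x` is the block that contains `z x`. As `0 <
  -- l x`, a point off the wall is never pulled onto it: its distance to the wall would drop below
  -- that of its projection.
  set z : X → X := fun x => seg (π x) x (l x) with hz
  have hzc : Continuous z := by
    have := hX.continuousOn_seg.comp_continuous (f := fun x => (π x, x, l x)) (by fun_prop)
      fun x => ⟨(hl0 x).le, (hl1 x).le⟩
    exact this
  have hzd : ∀ x, dist (z x) (π x) < ε := fun x => by
    rw [dist_comm, (hX.seg_spec (π x) x (hl0 x).le (hl1 x).le).1, dist_comm]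
    exact hld x
  refine ⟨z ⁻¹' B, z ⁻¹' B', (h𝓑.isClosed B hB).preimage hzc, (h𝓑.isClosed B' hB').preimage hzc,
    ?_, ?_, ?_, ?_⟩
  · refine Set.eq_univ_of_forall fun x => ?_
    obtain ⟨D, hD, hxD⟩ := h𝓑.exists_mem (z x)
    rcases hε.eq_or_eq hB hB' hD hne (hπd x).1 hxD (hzd x) with rfl | rfl
    · exact Or.inl hxD
    · exact Or.inr hxD
  · ext x
    constructor
    · intro hx
      have hx' : z x ∈ B ∩ B' := hx
      have h1 := Metric.infDist_le_dist_of_mem (x := x) hx'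
      rw [(hπd x).2, dist_comm x (z x), (hX.seg_spec (π x) x (hl0 x).le (hl1 x).le).2,
        dist_comm x] at h1
      have h2 : dist (π x) x = 0 := by
        have := mul_nonneg (hl0 x).le (dist_nonneg (x := π x) (y := x))
        have : l x * dist (π x) x = 0 := by linarith
        exact (mul_eq_zero.1 this).resolve_left (hl0 x).ne'
      rw [← dist_eq_zero.1 h2]
      exact (hπd x).1
    · intro hx
      have := hX.seg_mem hWc (hπd x).1 hx (hl0 x).le (hl1 x).le
      exact this
  · intro x hx
    exact hX.seg_mem (h𝓑.convex B hB) (hπd x).1.1 hx (hl0 x).le (hl1 x).le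
  · intro x hx
    exact hX.seg_mem (h𝓑.convex B' hB') (hπd x).1.2 hx (hl0 x).le (hl1 x).le

theorem IsCAT0.exists_btw_mem_inter {X : Type*} [MetricSpace X] (hX : IsCAT0 X) {N F : Set X}
    (hN : IsClosed N) (hF : IsClosed F) (hNF : N ∪ F = Set.univ) {x y : X} (hx : x ∈ N)
    (hy : y ∈ F) : ∃ w ∈ N ∩ F, MetricBtw x w y := by
  have hpre := isPreconnected_Icc.image _ (hX.continuousOn_seg_param x y)
  obtain ⟨w, ⟨l, hl, rfl⟩, hw⟩ := isPreconnected_closed_iff.1 hpre N F hN hF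
    (by rw [hNF]; exact Set.subset_univ _)
    ⟨x, ⟨0, by simp, hX.seg_zero x y⟩, hx⟩ ⟨y, ⟨1, by simp, hX.seg_one x y⟩, hy⟩
  exact ⟨_, hw, hX.btw_seg x y hl.1 hl.2⟩

/-- A geodesic that leaves `N` and comes back meets `N ∩ F` before and after the excursion, and
convexity of `N ∩ F` forbids the excursion. -/
theorem IsCAT0.geodConvex_of_separated {X : Type*} [MetricSpace X] (hX : IsCAT0 X) {N F : Set X}
    (hN : IsClosed N) (hF : IsClosed F) (hNF : N ∪ F = Set.univ) (hW : GeodConvex (N ∩ F)) :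
    GeodConvex N := by
  intro x hx y hy z hz
  by_contra hzN
  have hzF : z ∈ F := (hNF.symm ▸ Set.mem_univ z : z ∈ N ∪ F).resolve_left hzN
  obtain ⟨w, hw, h1⟩ := hX.exists_btw_mem_inter hN hF hNF hx hzF
  obtain ⟨w', hw', h2⟩ := hX.exists_btw_mem_inter hN hF hNF hy hzF
  refine hzN (hW w hw w' hw' z ?_).1
  unfold MetricBtw at *
  have t1 := dist_triangle4 x w w' y
  have t2 := dist_triangle w z w'
  rw [dist_comm w' z] at h2
  rw [dist_comm y w', dist_comm y z] at h2
  linarith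

/-! ### Gates -/

/-- A wall, together with the two sides into which it separates the space; the base point is not
on the far side. -/
structure Gate {X : Type*} [MetricSpace X] (𝓑 : Set (Set X)) (x₀ : X) where
  inner : Set X
  outer : Set X
  near : Set X
  far : Set X
  inner_mem : inner ∈ 𝓑
  outer_mem : outer ∈ 𝓑
  ne : inner ≠ outer
  wall_nonempty : (inner ∩ outer).Nonempty
  isClosed_near : IsClosed near
  isClosed_far : IsClosed far
  near_union_far : near ∪ far = Set.univ
  near_inter_far : near ∩ far = inner ∩ outer
  inner_subset : inner ⊆ near
  outer_subset : outer ⊆ far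
  base_not_mem : x₀ ∉ far

namespace Gate

variable {X : Type*} [MetricSpace X] {𝓑 : Set (Set X)} {x₀ : X}

/-- The wall of a gate. -/
def wall (G : Gate 𝓑 x₀) : Set X := G.inner ∩ G.outer

theorem mem_far (G : Gate 𝓑 x₀) {x : X} (h : x ∉ G.near) : x ∈ G.far :=
  (G.near_union_far.symm ▸ Set.mem_univ x : x ∈ G.near ∪ G.far).resolve_left h

theorem mem_near (G : Gate 𝓑 x₀) {x : X} (h : x ∉ G.far) : x ∈ G.near :=
  (G.near_union_far.symm ▸ Set.mem_univ x : x ∈ G.near ∪ G.far).resolve_right h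

theorem base_mem_near (G : Gate 𝓑 x₀) : x₀ ∈ G.near := G.mem_near G.base_not_mem

theorem mem_wall (G : Gate 𝓑 x₀) {x : X} (h : x ∈ G.near) (h' : x ∈ G.far) : x ∈ G.wall := by
  unfold wall
  rw [← G.near_inter_far]
  exact ⟨h, h'⟩

theorem wall_convex (h𝓑 : IsBlockDecomposition 𝓑) (G : Gate 𝓑 x₀) : GeodConvex G.wall :=
  (h𝓑.convex _ G.inner_mem).inter (h𝓑.convex _ G.outer_mem)

theorem near_convex (hX : IsCAT0 X) (h𝓑 : IsBlockDecomposition 𝓑) (G : Gate 𝓑 x₀) :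
    GeodConvex G.near := by
  refine hX.geodConvex_of_separated G.isClosed_near G.isClosed_far G.near_union_far ?_
  rw [G.near_inter_far]
  exact G.wall_convex h𝓑

theorem far_convex (hX : IsCAT0 X) (h𝓑 : IsBlockDecomposition 𝓑) (G : Gate 𝓑 x₀) :
    GeodConvex G.far := by
  refine hX.geodConvex_of_separated G.isClosed_far G.isClosed_near
    ((Set.union_comm _ _).trans G.near_union_far) ?_
  rw [Set.inter_comm, G.near_inter_far]
  exact G.wall_convex h𝓑

theorem disjoint_near (G : Gate 𝓑 x₀) {S : Set X} (hS : IsPreconnected S)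
    (hd : Disjoint S G.wall) {p : X} (hp : p ∈ S) (hpn : p ∉ G.near) : Disjoint S G.near := by
  rw [Set.disjoint_left]
  intro y hy hyn
  obtain ⟨z, hz, hzn, hzf⟩ := isPreconnected_closed_iff.1 hS G.near G.far G.isClosed_near
    G.isClosed_far (by rw [G.near_union_far]; exact Set.subset_univ _) ⟨y, hy, hyn⟩
    ⟨p, hp, G.mem_far hpn⟩
  exact Set.disjoint_left.1 hd hz (G.mem_wall hzn hzf)

/-- If the walls met, both blocks of `G'` would be blocks of `G`, so one would be `G.inner`, which
lies on the near side together with `p`. So the walls are disjoint, and the connected wall of `G'`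
stays on one side. -/
theorem wall_disjoint_near (hX : IsCAT0 X) (h𝓑 : IsBlockDecomposition 𝓑) (G G' : Gate 𝓑 x₀)
    {p : X} (hp : p ∈ G'.wall) (hpn : p ∉ G.near) : Disjoint G'.wall G.near := by
  refine G.disjoint_near (hX.isPreconnected (G'.wall_convex h𝓑)) ?_ hp hpn
  rw [Set.disjoint_left]
  intro y hy hy'
  obtain ⟨ε, hε⟩ := h𝓑.exists_separationRadius
  have hyy : dist y y < ε := by rw [dist_self]; exact hε.pos
  have h1 := hε.eq_or_eq G.inner_mem G.outer_mem G'.inner_mem G.ne hy' hy.1 hyy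
  have h2 := hε.eq_or_eq G.inner_mem G.outer_mem G'.outer_mem G.ne hy' hy.2 hyy
  have h3 := G'.ne
  refine hpn (G.inner_subset ?_)
  unfold wall at hp
  rcases h1 with h1 | h1 <;> rcases h2 with h2 | h2
  · exact absurd (h1.trans h2.symm) h3
  · exact h1 ▸ hp.1
  · exact h2 ▸ hp.2
  · exact absurd (h1.trans h2.symm) h3

theorem subset_far (hX : IsCAT0 X) (h𝓑 : IsBlockDecomposition 𝓑) (G : Gate 𝓑 x₀) {C : Set X}
    (hC : C ∈ 𝓑) {p : X} (hp : p ∈ C) (hpn : p ∉ G.near) : C ⊆ G.far := by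
  by_cases h1 : C = G.outer
  · rw [h1]; exact G.outer_subset
  have h2 : C ≠ G.inner := fun h => hpn (G.inner_subset (h ▸ hp))
  have hd : Disjoint C G.near := by
    refine G.disjoint_near (hX.isPreconnected (h𝓑.convex C hC)) ?_ hp hpn
    rw [Set.disjoint_left]
    intro y hy hy'
    obtain ⟨ε, hε⟩ := h𝓑.exists_separationRadius
    rcases hε.eq_or_eq G.inner_mem G.outer_mem hC G.ne hy' hy
      (by rw [dist_self]; exact hε.pos) with h | h
    · exact h2 h
    · exact h1 h
  exact fun y hy => G.mem_far (Set.disjoint_left.1 hd hy)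

/-- The far side is the union of the blocks that it contains. -/
theorem exists_block_subset_far (hX : IsCAT0 X) (h𝓑 : IsBlockDecomposition 𝓑) (G : Gate 𝓑 x₀)
    {x : X} (hx : x ∈ G.far) : ∃ C ∈ 𝓑, C ⊆ G.far ∧ x ∈ C := by
  by_cases h : x ∈ G.near
  · exact ⟨G.outer, G.outer_mem, G.outer_subset, (G.mem_wall h hx).2⟩
  · obtain ⟨C, hC, hxC⟩ := h𝓑.exists_mem x
    exact ⟨C, hC, G.subset_far hX h𝓑 hC hxC h, hxC⟩

/-- The ray `c` passes the gate `G`. -/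
def Crossed (G : Gate 𝓑 x₀) (c : VisualBoundary x₀) : Prop := ∃ t, c.ray t ∉ G.near

/-- The near side is convex and contains the base point, so a ray never returns to it. -/
theorem not_mem_near_of_le (hX : IsCAT0 X) (h𝓑 : IsBlockDecomposition 𝓑) (G : Gate 𝓑 x₀)
    {c : VisualBoundary x₀} {s t : ℝ≥0} (hs : c.ray s ∉ G.near) (h : s ≤ t) :
    c.ray t ∉ G.near := fun ht =>
  hs (G.near_convex hX h𝓑 _ (by rw [c.ray_zero]; exact G.base_mem_near) _ ht _
    (c.btw_ray zero_le h))

theorem exists_crossing (hX : IsCAT0 X) (h𝓑 : IsBlockDecomposition 𝓑) (G : Gate 𝓑 x₀)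
    {c : VisualBoundary x₀} {t : ℝ≥0} (ht : c.ray t ∉ G.near) :
    ∃ s < t, c.ray s ∈ G.wall ∧ ∀ u, s < u → c.ray u ∉ G.near := by
  have hcl : IsClosed {s | c.ray s ∈ G.near} :=
    G.isClosed_near.preimage c.isometry_ray.continuous
  have hne : {s | c.ray s ∈ G.near}.Nonempty :=
    ⟨0, by simp only [Set.mem_ofPred_eq, c.ray_zero]; exact G.base_mem_near⟩
  have hbd : BddAbove {s | c.ray s ∈ G.near} :=
    ⟨t, fun s hs => le_of_not_ge fun h => G.not_mem_near_of_le hX h𝓑 ht h hs⟩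
  have hmem := hcl.csSup_mem hne hbd
  set s := sSup {s | c.ray s ∈ G.near} with hs
  have hu : ∀ u, s < u → c.ray u ∉ G.near := fun u hu hun => absurd (le_csSup hbd hun) (not_le.2 hu)
  have hst : s < t := lt_of_not_ge fun h => G.not_mem_near_of_le hX h𝓑 ht h hmem
  refine ⟨s, hst, G.mem_wall hmem ?_, hu⟩
  have hfar : IsClosed {s | c.ray s ∈ G.far} := G.isClosed_far.preimage c.isometry_ray.continuous
  have : closure (Set.Ioi s) ⊆ {s | c.ray s ∈ G.far} :=
    closure_minimal (fun u hu' => G.mem_far (hu u hu')) hfar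
  rw [closure_Ioi' ⟨t, hst⟩] at this
  exact this (Set.mem_Ici.2 le_rfl)

/-- Within `ε` of the crossing point only the two blocks of the gate are present, and past it the
inner one is excluded, being on the near side. -/
theorem Crossed.enters (hX : IsCAT0 X) (h𝓑 : IsBlockDecomposition 𝓑) {G : Gate 𝓑 x₀}
    {c : VisualBoundary x₀} (h : G.Crossed c) : Enters 𝓑 c G.outer := by
  obtain ⟨t, ht⟩ := h
  obtain ⟨s, -, hsw, hs⟩ := G.exists_crossing hX h𝓑 ht
  obtain ⟨ε, hε⟩ := h𝓑.exists_separationRadius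
  set u : ℝ≥0 := s + ⟨ε / 2, (half_pos hε.pos).le⟩ with hu
  have hu' : (u : ℝ) = s + ε / 2 := by rw [hu]; rfl
  have hsu : s < u := by
    rw [← NNReal.coe_lt_coe, hu']; linarith [hε.pos]
  have hd : dist (c.ray u) (c.ray s) < ε := by
    rw [c.dist_ray, hu', add_sub_cancel_left, abs_of_pos (half_pos hε.pos)]
    exact half_lt_self hε.pos
  have hon : ∀ D ∈ 𝓑, c.ray u ∈ D → D = G.outer := by
    intro D hD huD
    refine (hε.eq_or_eq G.inner_mem G.outer_mem hD G.ne hsw huD hd).resolve_left ?_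
    rintro rfl
    exact hs u hsu (G.inner_subset huD)
  obtain ⟨D, hD, huD⟩ := h𝓑.exists_mem (c.ray u)
  exact ⟨u, G.outer_mem, hon D hD huD ▸ huD, fun D' hD' hne h' => hne (hon D' hD' h')⟩

/-- The gate is the wall between `C` and the block that the ray is in just before its first visit to
`C`. -/
theorem exists_of_enters [ProperSpace X] (hX : IsCAT0 X) (h𝓑 : IsBlockDecomposition 𝓑)
    {c : VisualBoundary x₀} {C : Set X} (hx₀ : x₀ ∉ C) (h : Enters 𝓑 c C) :
    ∃ G : Gate 𝓑 x₀, G.outer = C ∧ G.Crossed c := by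
  obtain ⟨t, hC, htC, ht⟩ := h
  obtain ⟨ε, hε⟩ := h𝓑.exists_separationRadius
  have hcl : IsClosed {s | c.ray s ∈ C} := (h𝓑.isClosed C hC).preimage c.isometry_ray.continuous
  have hne : {s | c.ray s ∈ C}.Nonempty := ⟨t, htC⟩
  have hmem := hcl.csInf_mem hne (OrderBot.bddBelow _)
  have hle : sInf {s | c.ray s ∈ C} ≤ t :=
    csInf_le (OrderBot.bddBelow _) (show t ∈ {s | c.ray s ∈ C} from htC)
  have hnot : ∀ u < sInf {s | c.ray s ∈ C}, c.ray u ∉ C := fun u hu h' =>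
    absurd (csInf_le (OrderBot.bddBelow _) (show u ∈ {s | c.ray s ∈ C} from h')) (not_le.2 hu)
  set s := sInf {s | c.ray s ∈ C} with hs
  have hs0 : 0 < s := by
    refine pos_of_ne_zero fun h0 => hx₀ ?_
    have : c.ray s ∈ C := hmem
    rwa [h0, c.ray_zero] at this
  -- The subtraction is truncated at `0`; since `0 < s`, the interval `(a, s)` is nonempty all the
  -- same.
  set a : ℝ≥0 := s - ⟨ε, hε.pos.le⟩ with ha
  have has : a < s := tsub_lt_self hs0 (by exact hε.pos)
  have hnear : ∀ u ∈ Set.Ioo a s, dist (c.ray u) (c.ray s) < ε := by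
    intro u hu
    have h1 : (u : ℝ) < s := hu.2
    have h2 : s < u + ⟨ε, hε.pos.le⟩ := lt_add_of_tsub_lt_right hu.1
    have h3 : (s : ℝ) < u + ε := h2
    rw [c.dist_ray, abs_of_neg (by linarith)]
    linarith
  obtain ⟨v, hv⟩ : (Set.Ioo a s).Nonempty := Set.nonempty_Ioo.2 has
  obtain ⟨B, hB, hvB⟩ := h𝓑.exists_mem (c.ray v)
  have hBC : B ≠ C := fun h' => hnot v hv.2 (h' ▸ hvB)
  have hall : ∀ u ∈ Set.Ioo a s, c.ray u ∈ B := by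
    intro u hu
    obtain ⟨D, hD, huD⟩ := h𝓑.exists_mem (c.ray u)
    rcases hε.two (c.ray s) B hB C hC D hD ⟨_, hvB, hnear v hv⟩ (hε.nonempty_inter_ball hmem)
      ⟨_, huD, hnear u hu⟩ hBC with h' | h'
    · exact h' ▸ huD
    · exact absurd (h' ▸ huD) (hnot u hu.2)
  have hsB : c.ray s ∈ B := by
    have : closure (Set.Ioo a s) ⊆ {u | c.ray u ∈ B} :=
      closure_minimal hall ((h𝓑.isClosed B hB).preimage c.isometry_ray.continuous)
    rw [closure_Ioo has.ne] at this
    exact this ⟨has.le, le_rfl⟩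
  obtain ⟨N, F, hN, hF, hNF, hW, hBN, hCF⟩ := h𝓑.exists_sides hX hB hC hBC ⟨_, hsB, hmem⟩
  have hFc : GeodConvex F := by
    refine hX.geodConvex_of_separated hF hN ((Set.union_comm _ _).trans hNF) ?_
    rw [Set.inter_comm, hW]
    exact (h𝓑.convex B hB).inter (h𝓑.convex C hC)
  refine ⟨⟨B, C, N, F, hB, hC, hBC, ⟨_, hsB, hmem⟩, hN, hF, hNF, hW, hBN, hCF, ?_⟩, rfl, t, ?_⟩
  -- If the base point were on the far side, convexity would put `c.ray v` on both sides, hence in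
  -- `C` before the first visit.
  · intro h0
    have hvF : c.ray v ∈ F := hFc _ (by rwa [← c.ray_zero] at h0) _ (hCF htC) _
      (c.btw_ray zero_le (hv.2.le.trans hle))
    have : c.ray v ∈ B ∩ C := hW ▸ ⟨hBN hvB, hvF⟩
    exact hnot v hv.2 this.2
  · intro htN
    have : c.ray t ∈ B ∩ C := hW ▸ ⟨htN, hCF htC⟩
    exact ht B hB hBC this.1

end Gate

/-! ### Itineraries in terms of gates; rational and irrational rays -/

theorem inOnly_base {X : Type*} {𝓑 : Set (Set X)} {x₀ : X} (hx₀ : ∀ W ∈ walls 𝓑, x₀ ∉ W)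
    {B : Set X} (hB : B ∈ 𝓑) (h : x₀ ∈ B) :
    InOnly 𝓑 B x₀ :=
  ⟨hB, h, fun B' hB' hne h' =>
    hx₀ (B ∩ B') ⟨B, hB, B', hB', hne.symm, rfl, ⟨x₀, h, h'⟩⟩ ⟨h, h'⟩⟩

section

variable {X : Type*} [MetricSpace X] {𝓑 : Set (Set X)} {x₀ : X}

namespace Gate

/-- Every ray enters the block of the base point at time `0`; all other blocks are detected by
gates. -/
theorem enters_of_forall_crossed [ProperSpace X] (hX : IsCAT0 X) (h𝓑 : IsBlockDecomposition 𝓑)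
    (hx₀ : ∀ W ∈ walls 𝓑, x₀ ∉ W) {c c' : VisualBoundary x₀}
    (h : ∀ G : Gate 𝓑 x₀, G.Crossed c → G.Crossed c') {B : Set X} (hB : Enters 𝓑 c B) :
    Enters 𝓑 c' B := by
  by_cases h0 : x₀ ∈ B
  · obtain ⟨t, ht⟩ := hB
    exact ⟨0, by rw [c'.ray_zero]; exact inOnly_base hx₀ ht.1 h0⟩
  · obtain ⟨G, rfl, hG⟩ := exists_of_enters hX h𝓑 h0 hB
    exact (h G hG).enters hX h𝓑

theorem entersBefore_of_forall_crossed [ProperSpace X] (hX : IsCAT0 X)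
    (h𝓑 : IsBlockDecomposition 𝓑) (hx₀ : ∀ W ∈ walls 𝓑, x₀ ∉ W) {c c' : VisualBoundary x₀}
    (h : ∀ G : Gate 𝓑 x₀, G.Crossed c → G.Crossed c') {B B' : Set X} (hne : B ≠ B')
    (hBB' : EntersBefore 𝓑 c B B') : EntersBefore 𝓑 c' B B' := by
  obtain ⟨s, t, hst, hs, ht⟩ := hBB'
  obtain ⟨s', hs'⟩ := enters_of_forall_crossed hX h𝓑 hx₀ h ⟨s, hs⟩
  obtain ⟨t', ht'⟩ := enters_of_forall_crossed hX h𝓑 hx₀ h ⟨t, ht⟩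
  by_cases h0 : x₀ ∈ B
  · refine ⟨0, t', pos_of_ne_zero ?_, by rw [c'.ray_zero]; exact inOnly_base hx₀ hs.1 h0, ht'⟩
    rintro rfl
    rw [c'.ray_zero] at ht'
    exact ht'.2.2 B hs.1 hne h0
  · refine ⟨s', t', ?_, hs', ht'⟩
    by_contra hcon
    -- In the wrong order, `c'` would be in `B'`, beyond the gate into `B`, and later in `B`. It met
    -- `B` at that gate already, so convexity of `B` puts the visit to `B'` inside `B`.
    have hts : t' ≤ s' := not_lt.1 hcon
    obtain ⟨G, rfl, hG⟩ := exists_of_enters hX h𝓑 h0 ⟨s, hs⟩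
    obtain ⟨v, hv⟩ := h G hG
    have hsn : c.ray s ∉ G.near := fun hn =>
      hs.2.2 G.inner G.inner_mem G.ne (G.mem_wall hn (G.outer_subset hs.2.1)).1
    have htn := G.not_mem_near_of_le hX h𝓑 hsn hst.le
    have htf := G.subset_far hX h𝓑 ht.1 ht.2.1 htn ht'.2.1
    have ht'o : c'.ray t' ∉ G.outer := ht'.2.2 _ G.outer_mem hne
    have ht'n : c'.ray t' ∉ G.near := fun hn => ht'o (G.mem_wall hn htf).2
    obtain ⟨w, hwt, hw, -⟩ := G.exists_crossing hX h𝓑 ht'n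
    exact ht'o (h𝓑.convex _ G.outer_mem _ hw.2 _ hs'.2.1 _ (c'.btw_ray hwt.le hts))

theorem sameItinerary [ProperSpace X] (hX : IsCAT0 X) (h𝓑 : IsBlockDecomposition 𝓑)
    (hx₀ : ∀ W ∈ walls 𝓑, x₀ ∉ W) {c c' : VisualBoundary x₀}
    (h : ∀ G : Gate 𝓑 x₀, G.Crossed c ↔ G.Crossed c') : SameItinerary 𝓑 c c' :=
  ⟨fun _ => ⟨enters_of_forall_crossed hX h𝓑 hx₀ fun G => (h G).1,
    enters_of_forall_crossed hX h𝓑 hx₀ fun G => (h G).2⟩,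
  fun _ _ hne => ⟨entersBefore_of_forall_crossed hX h𝓑 hx₀ (fun G => (h G).1) hne,
    entersBefore_of_forall_crossed hX h𝓑 hx₀ (fun G => (h G).2) hne⟩⟩

end Gate

theorem IsBlockDecomposition.finite_meeting_closedBall [ProperSpace X]
    (h𝓑 : IsBlockDecomposition 𝓑) (x : X) (R : ℝ) :
    {B ∈ 𝓑 | (B ∩ Metric.closedBall x R).Nonempty}.Finite := by
  obtain ⟨ε, hε⟩ := h𝓑.exists_separationRadius
  have hfin : ∀ y, {B ∈ 𝓑 | (B ∩ Metric.ball y ε).Nonempty}.Finite := by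
    intro y
    by_contra hinf
    obtain ⟨B, hB⟩ := Set.Infinite.nonempty hinf
    obtain ⟨B', hB', hne⟩ := Set.Infinite.exists_notMem_finite hinf (Set.finite_singleton B)
    obtain ⟨D, hD, hDne⟩ := Set.Infinite.exists_notMem_finite hinf (Set.toFinite {B, B'})
    have h1 : B ≠ B' := fun h => hne (by simp [h])
    rcases hε.two y B hB.1 B' hB'.1 D hD.1 hB.2 hB'.2 hD.2 h1 with rfl | rfl <;> simp at hDne
  obtain ⟨t, -, ht⟩ := (isCompact_closedBall x R).elim_finite_subcover_image
    (b := Set.univ) (c := fun y => Metric.ball y ε) (fun _ _ => Metric.isOpen_ball)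
    (fun y _ => Set.mem_biUnion (Set.mem_univ y) (Metric.mem_ball_self hε.pos))
  refine (ht.1.biUnion fun y _ => hfin y).subset ?_
  rintro B ⟨hB, y, hyB, hyR⟩
  obtain ⟨z, hz, hyz⟩ := Set.mem_iUnion₂.1 (ht.2 hyR)
  exact Set.mem_biUnion hz ⟨hB, y, hyB, hyz⟩

/-- Only finitely many blocks meet a given ball, so an irrational ray enters one outside it. -/
theorem IsIrrational.exists_gate [ProperSpace X] (hX : IsCAT0 X) (h𝓑 : IsBlockDecomposition 𝓑)
    {c : VisualBoundary x₀} (hc : IsIrrational 𝓑 c) (R : ℝ) :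
    ∃ G : Gate 𝓑 x₀, G.Crossed c ∧ ∀ x ∈ G.outer, R < dist x₀ x := by
  obtain ⟨B, hB, hBR⟩ := hc.exists_notMem_finite
    (h𝓑.finite_meeting_closedBall x₀ (max R 0))
  have hBmem : B ∈ 𝓑 := by obtain ⟨t, ht⟩ := hB; exact ht.1
  have hfar : ∀ x ∈ B, max R 0 < dist x₀ x := by
    intro x hx
    by_contra hcon
    refine hBR ⟨hBmem, x, hx, ?_⟩
    rw [Metric.mem_closedBall, dist_comm]
    exact not_lt.1 hcon
  have h0 : x₀ ∉ B := fun h => by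
    have := hfar x₀ h
    rw [dist_self] at this
    exact absurd this (not_lt.2 (le_max_right _ _))
  obtain ⟨G, rfl, hG⟩ := Gate.exists_of_enters hX h𝓑 h0 hB
  exact ⟨G, hG, fun x hx => (le_max_left _ _).trans_lt (hfar x hx)⟩

theorem exists_inOnly_or_forall_mem (h𝓑 : IsBlockDecomposition 𝓑) (c : VisualBoundary x₀)
    {B : Set X} (hB : B ∈ 𝓑) {T : ℝ≥0} (hT : c.ray T ∈ B) :
    (∃ D, ∃ t ≥ T, InOnly 𝓑 D (c.ray t)) ∨ ∀ t ≥ T, c.ray t ∈ B := by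
  rw [or_iff_not_imp_right]
  intro hcon
  push Not at hcon
  obtain ⟨t, hTt, ht⟩ := hcon
  obtain ⟨ε, hε⟩ := h𝓑.exists_separationRadius
  have hcl : IsClosed {s | T ≤ s ∧ c.ray s ∈ B} :=
    isClosed_Ici.inter ((h𝓑.isClosed B hB).preimage c.isometry_ray.continuous)
  have hne : {s | T ≤ s ∧ c.ray s ∈ B}.Nonempty := ⟨T, le_rfl, hT⟩
  have hbd : BddAbove {s | T ≤ s ∧ c.ray s ∈ B} := by
    refine ⟨t, fun s hs => le_of_not_ge fun h => ht ?_⟩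
    exact h𝓑.convex B hB _ hT _ hs.2 _ (c.btw_ray hTt h)
  have hmem := hcl.csSup_mem hne hbd
  set s := sSup {s | T ≤ s ∧ c.ray s ∈ B} with hs
  set u : ℝ≥0 := s + ⟨ε / 2, (half_pos hε.pos).le⟩ with hu
  have hu' : (u : ℝ) = s + ε / 2 := by rw [hu]; rfl
  have hsu : s < u := by
    rw [← NNReal.coe_lt_coe, hu']; linarith [hε.pos]
  have hTu : T ≤ u := hmem.1.trans hsu.le
  have huB : c.ray u ∉ B := fun h =>
    absurd (le_csSup hbd (show u ∈ {s | T ≤ s ∧ c.ray s ∈ B} from ⟨hTu, h⟩)) (not_le.2 hsu)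
  have hd : dist (c.ray u) (c.ray s) < ε := by
    rw [c.dist_ray, hu', add_sub_cancel_left, abs_of_pos (half_pos hε.pos)]
    exact half_lt_self hε.pos
  obtain ⟨D, hD, huD⟩ := h𝓑.exists_mem (c.ray u)
  have hBD : B ≠ D := fun h => huB (h ▸ huD)
  refine ⟨D, u, hTu, hD, huD, fun D' hD' hne' h' => ?_⟩
  rcases hε.two (c.ray s) B hB D hD D' hD' (hε.nonempty_inter_ball hmem.2) ⟨_, huD, hd⟩
    ⟨_, h', hd⟩ hBD with h | h
  · exact huB (h ▸ h')
  · exact hne' h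

/-- A rational ray eventually stays in a block. -/
theorem exists_block_of_not_isIrrational (h𝓑 : IsBlockDecomposition 𝓑) {c : VisualBoundary x₀}
    (hc : ¬ IsIrrational 𝓑 c) : ∃ B ∈ 𝓑, ∃ T, ∀ t ≥ T, c.ray t ∈ B := by
  by_contra! hcon
  have h1 : ∀ n : ℕ, ∃ D, ∃ t : ℝ≥0, (n : ℝ≥0) ≤ t ∧ InOnly 𝓑 D (c.ray t) := by
    intro n
    obtain ⟨B, hB, hnB⟩ := h𝓑.exists_mem (c.ray n)
    rcases exists_inOnly_or_forall_mem h𝓑 c hB hnB with ⟨D, t, ht, hD⟩ | h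
    · exact ⟨D, t, ht, hD⟩
    · obtain ⟨t, ht, ht'⟩ := hcon B hB n
      exact absurd (h t ht) ht'
  choose D t ht hD using h1
  have hfin : {B | Enters 𝓑 c B}.Finite := Set.not_infinite.1 hc
  -- A block visited at arbitrarily late times would, by convexity, contain a whole tail of the ray.
  -- With finitely many blocks entered, no value is left for `D n`.
  have hne : ∀ B ∈ {B | Enters 𝓑 c B}, ∀ᶠ n in atTop, D n ≠ B := by
    intro B hB
    by_contra hfr
    have hfr' : ∃ᶠ n in atTop, D n = B := fun h => hfr h
    obtain ⟨n, rfl⟩ := hfr'.exists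
    obtain ⟨s, hs, hsD⟩ := hcon (D n) (hD n).1 (t n)
    obtain ⟨m, hm⟩ := exists_nat_ge s
    obtain ⟨k, hk, hkD⟩ := frequently_atTop.1 hfr' m
    have hsk : s ≤ t k := (hm.trans (by exact_mod_cast hk)).trans (ht k)
    refine hsD (h𝓑.convex _ (hD n).1 _ (hD n).2.1 _ ?_ _ (c.btw_ray hs hsk))
    rw [← hkD]
    exact (hD k).2.1
  obtain ⟨n, hn⟩ := ((eventually_all_finite hfin).2 hne).exists
  exact hn (D n) ⟨t n, hD n⟩ rfl

/-- If `c` leaves `H.near`, so does the segment to some `y i`, hence `y i` itself. Then the whole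
wall of `G i` avoids `H.near`, and `a` meets that wall. -/
theorem Gate.Crossed.of_limit (hX : IsCAT0 X) (h𝓑 : IsBlockDecomposition 𝓑) {ι : Type*}
    {U : Filter ι} [U.NeBot] {a c : VisualBoundary x₀} {G : ι → Gate 𝓑 x₀} {y : ι → X}
    (hG : ∀ i, (G i).Crossed a) (hy : ∀ᶠ i in U, y i ∈ (G i).wall)
    (hd : Tendsto (fun i => dist x₀ (y i)) U atTop)
    (hc : ∀ r : ℝ≥0, Tendsto (fun i => gpt x₀ (y i) r) U (𝓝 (c.ray r))) {H : Gate 𝓑 x₀}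
    (hH : H.Crossed c) : H.Crossed a := by
  obtain ⟨s, hs⟩ := hH
  obtain ⟨i, h1, h2, h3⟩ := (((hc s).eventually (H.isClosed_near.isOpen_compl.mem_nhds hs)).and
    (hy.and (hd.eventually_ge_atTop (s : ℝ)))).exists
  have hyn : y i ∉ H.near := fun h =>
    h1 (hX.gpt_mem (H.near_convex hX h𝓑) H.base_mem_near h s.coe_nonneg h3)
  have hdisj := H.wall_disjoint_near hX h𝓑 (G i) h2 hyn
  obtain ⟨t, ht⟩ := hG i
  obtain ⟨u, -, hu, -⟩ := (G i).exists_crossing hX h𝓑 ht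
  exact ⟨u, Set.disjoint_left.1 hdisj hu⟩

/-- An irrational `c` crosses some gate `H` far out, and so does `a`, after it has passed `G`. The
wall of `H` then lies wholly beyond `G`, and `c` meets it. -/
theorem Gate.Crossed.of_isIrrational [ProperSpace X] (hX : IsCAT0 X) (h𝓑 : IsBlockDecomposition 𝓑)
    {a c : VisualBoundary x₀} (hc : IsIrrational 𝓑 c)
    (hca : ∀ H : Gate 𝓑 x₀, H.Crossed c → H.Crossed a) {G : Gate 𝓑 x₀} (hG : G.Crossed a) :
    G.Crossed c := by
  obtain ⟨t, ht⟩ := hG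
  obtain ⟨H, hH, hHt⟩ := hc.exists_gate hX h𝓑 t
  obtain ⟨s, hs⟩ := hca H hH
  obtain ⟨u, -, hu, -⟩ := H.exists_crossing hX h𝓑 hs
  have htu : t ≤ u := by
    have := hHt _ hu.2
    rw [a.dist_base_ray] at this
    exact_mod_cast this.le
  have hdisj := G.wall_disjoint_near hX h𝓑 H hu (G.not_mem_near_of_le hX h𝓑 ht htu)
  obtain ⟨s', hs'⟩ := hH
  obtain ⟨u', -, hu', -⟩ := H.exists_crossing hX h𝓑 hs'
  exact ⟨u', Set.disjoint_left.1 hdisj hu'⟩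

end

/-! ### Boundaries of blocks, seen from the base point -/

namespace VisualBoundary

/-- A ray that stays in a subspace, as a ray of the subspace. -/
def restrict {X : Type*} [MetricSpace X] {B : Set X} {b : B} (c : VisualBoundary (b : X))
    (h : ∀ t, c.ray t ∈ B) : VisualBoundary b where
  ray t := ⟨c.ray t, h t⟩
  isometry_ray := Isometry.of_dist_eq fun s t => c.isometry_ray.dist_eq s t
  ray_zero := Subtype.ext c.ray_zero

theorem incl_mem {X : Type*} [MetricSpace X] {B : Set X} {b : B} (c : VisualBoundary b) (t : ℝ≥0) :
    c.incl.ray t ∈ B := (c.ray t).2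

/-- The part of a ray that follows the time `T`. -/
def tail {X : Type*} [MetricSpace X] {x : X} (c : VisualBoundary x) (T : ℝ≥0) :
    VisualBoundary (c.ray T) where
  ray t := c.ray (T + t)
  isometry_ray := c.isometry_ray.comp (Isometry.of_dist_eq fun s t => by
    rw [NNReal.dist_eq, NNReal.dist_eq, NNReal.coe_add, NNReal.coe_add, add_sub_add_left_eq_sub])
  ray_zero := by rw [add_zero]

theorem rebase_tail {X : Type*} [MetricSpace X] [ProperSpace X] (hX : IsCAT0 X) {x : X}
    (c : VisualBoundary x) (T : ℝ≥0) : (c.tail T).rebase hX x = c := by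
  refine (eq_rebase hX (K := T) fun t => ?_).symm
  change dist (c.ray t) (c.ray (T + t)) ≤ T
  rw [c.dist_ray, NNReal.coe_add, abs_sub_comm, add_sub_cancel_right, abs_of_nonneg T.coe_nonneg]

/-- The rays from `x` that are asymptotic to a ray in `C`. -/
def asymptoticTo {X : Type*} [MetricSpace X] [ProperSpace X] (hX : IsCAT0 X) (x : X) (C : Set X) :
    Set (VisualBoundary x) :=
  {c | ∃ (y : X) (z : VisualBoundary y), (∀ t, z.ray t ∈ C) ∧ c = z.rebase hX x}

end VisualBoundary

open VisualBoundary

section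

variable {X : Type*} [MetricSpace X] [ProperSpace X] (hX : IsCAT0 X)
  {𝓑 : Set (Set X)} (h𝓑 : IsBlockDecomposition 𝓑)
  (hblock : ∀ B ∈ 𝓑, ∀ b : B, PathConnectedSpace (VisualBoundary b))
  (hwall : ∀ W ∈ walls 𝓑, ∀ w : W, Nonempty (VisualBoundary w)) (x₀ : X)

theorem asymptoticTo_nonempty {B : Set X} (b : B) [Nonempty (VisualBoundary b)] :
    (asymptoticTo hX x₀ B).Nonempty :=
  let ⟨c⟩ := ‹Nonempty (VisualBoundary b)›
  ⟨_, b, c.incl, c.incl_mem, rfl⟩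

-- Both rays are moved to a common base point in `B`, where they stay in `B` because it is closed
-- and convex. A path in the boundary of `B` is then carried to `x₀` by the continuous change of
-- base point.
include h𝓑 hblock in
theorem joinedIn_asymptoticTo {B : Set X} (hB : B ∈ 𝓑) {a a' : VisualBoundary x₀}
    (ha : a ∈ asymptoticTo hX x₀ B) (ha' : a' ∈ asymptoticTo hX x₀ B) :
    JoinedIn (asymptoticTo hX x₀ B) a a' := by
  obtain ⟨y, z, hz, rfl⟩ := ha
  obtain ⟨y', z', hz', rfl⟩ := ha'
  have hy : y ∈ B := z.ray_zero ▸ hz 0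
  let b : B := ⟨y, hy⟩
  have hz'' : ∀ t, (z'.rebase hX y).ray t ∈ B :=
    z'.rebase_mem hX (h𝓑.isClosed B hB) (h𝓑.convex B hB) hy hz'
  let d : VisualBoundary b := restrict (b := b) z hz
  let d' : VisualBoundary b := restrict (b := b) (z'.rebase hX y) hz''
  have := hblock B hB b
  obtain ⟨p⟩ := PathConnectedSpace.joined d d'
  have hf : Continuous fun e : VisualBoundary b => e.incl.rebase hX x₀ :=
    (continuous_rebase hX y x₀).comp (continuous_incl b)
  have e' : d'.incl.rebase hX x₀ = z'.rebase hX x₀ := z'.rebase_rebase hX y x₀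
  rw [← e']
  exact ⟨p.map hf, fun t => ⟨y, (p t).incl, (p t).incl_mem, rfl⟩⟩

include hblock hwall in
theorem asymptoticTo_inter_nonempty {B B' : Set X} (hB : B ∈ 𝓑) (hB' : B' ∈ 𝓑)
    (h : (B ∩ B').Nonempty) : (asymptoticTo hX x₀ B ∩ asymptoticTo hX x₀ B').Nonempty := by
  obtain ⟨w, hw⟩ := h
  by_cases hne : B = B'
  · subst hne
    rw [Set.inter_self]
    have := hblock B hB ⟨w, hw.1⟩
    exact asymptoticTo_nonempty hX x₀ ⟨w, hw.1⟩
  · obtain ⟨c⟩ := hwall (B ∩ B') ⟨B, hB, B', hB', hne, rfl, ⟨w, hw⟩⟩ ⟨w, hw⟩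
    exact ⟨c.incl.rebase hX x₀, ⟨w, c.incl, fun t => (c.incl_mem t).1, rfl⟩,
      ⟨w, c.incl, fun t => (c.incl_mem t).2, rfl⟩⟩

include h𝓑 hblock hwall in
/-- The boundaries of the blocks in a connected union of blocks form a path connected set. -/
theorem joinedIn_iUnion_asymptoticTo {S : Set X} (hS : IsPreconnected S)
    (hcov : ∀ x ∈ S, ∃ C ∈ 𝓑, C ⊆ S ∧ x ∈ C) {C C' : Set X} (hC : C ∈ 𝓑) (hC' : C' ∈ 𝓑)
    (hCS : C ⊆ S) (hCS' : C' ⊆ S) (hne : C.Nonempty) (hne' : C'.Nonempty)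
    {a a' : VisualBoundary x₀} (ha : a ∈ asymptoticTo hX x₀ C)
    (ha' : a' ∈ asymptoticTo hX x₀ C') :
    JoinedIn (⋃ D ∈ {D ∈ 𝓑 | D ⊆ S}, asymptoticTo hX x₀ D) a a' := by
  obtain ⟨ε, hε⟩ := h𝓑.exists_separationRadius
  -- Quantifying over all blocks at both points makes `P` transitive. It holds locally because
  -- blocks that meet a common `ε`-ball intersect; connectedness of `S` does the rest.
  let P : X → X → Prop := fun x y => ∀ C ∈ 𝓑, ∀ C' ∈ 𝓑, C ⊆ S → C' ⊆ S → x ∈ C → y ∈ C' →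
    ∀ a ∈ asymptoticTo hX x₀ C, ∀ a' ∈ asymptoticTo hX x₀ C',
      JoinedIn (⋃ D ∈ {D ∈ 𝓑 | D ⊆ S}, asymptoticTo hX x₀ D) a a'
  obtain ⟨x, hx⟩ := hne
  obtain ⟨x', hx'⟩ := hne'
  have key : P x x' := by
    refine hS.induction₂ P ?_ ?_ ?_ (hCS hx) (hCS' hx')
    · intro x hx
      filter_upwards [nhdsWithin_le_nhds (Metric.ball_mem_nhds x hε.pos)] with y hy
      intro C hC C' hC' hCS hCS' hxC hyC a ha a' ha'
      obtain ⟨b, hb, hb'⟩ := asymptoticTo_inter_nonempty hX hblock hwall x₀ hC hC'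
        (hε.inter x C hC C' hC' (hε.nonempty_inter_ball hxC) ⟨y, hyC, hy⟩)
      have h1 := joinedIn_asymptoticTo hX h𝓑 hblock x₀ hC ha hb
      have h2 := joinedIn_asymptoticTo hX h𝓑 hblock x₀ hC' hb' ha'
      have s1 : asymptoticTo hX x₀ C ⊆ ⋃ D ∈ {D ∈ 𝓑 | D ⊆ S}, asymptoticTo hX x₀ D :=
        Set.subset_biUnion_of_mem (u := fun D => asymptoticTo hX x₀ D)
          (show C ∈ {D ∈ 𝓑 | D ⊆ S} from ⟨hC, hCS⟩)
      have s2 : asymptoticTo hX x₀ C' ⊆ ⋃ D ∈ {D ∈ 𝓑 | D ⊆ S}, asymptoticTo hX x₀ D :=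
        Set.subset_biUnion_of_mem (u := fun D => asymptoticTo hX x₀ D)
          (show C' ∈ {D ∈ 𝓑 | D ⊆ S} from ⟨hC', hCS'⟩)
      exact (h1.mono s1).trans (h2.mono s2)
    · intro x y z _ hy _ hxy hyz C hC C' hC' hCS hCS' hxC hzC a ha a' ha'
      obtain ⟨D, hD, hDS, hyD⟩ := hcov y hy
      have := hblock D hD ⟨y, hyD⟩
      obtain ⟨d, hd⟩ := asymptoticTo_nonempty hX x₀ (⟨y, hyD⟩ : D)
      exact (hxy C hC D hD hCS hDS hxC hyD a ha d hd).trans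
        (hyz D hD C' hC' hDS hCS' hyD hzC d hd a' ha')
    · intro x y _ _ hxy C hC C' hC' hCS hCS' hxC hyC a ha a' ha'
      exact (hxy C' hC' C hC hCS' hCS hyC hxC a' ha' a ha).symm
  exact key C hC C' hC' hCS hCS' hx hx' a ha a' ha'

include h𝓑 in
theorem exists_mem_asymptoticTo {c : VisualBoundary x₀} (hc : ¬ IsIrrational 𝓑 c) :
    ∃ B ∈ 𝓑, B.Nonempty ∧ c ∈ asymptoticTo hX x₀ B := by
  obtain ⟨B, hB, T, hT⟩ := exists_block_of_not_isIrrational h𝓑 hc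
  exact ⟨B, hB, ⟨_, hT T le_rfl⟩, _, c.tail T, fun t => hT (T + t) le_self_add,
    (c.rebase_tail hX T).symm⟩

end

/-! ### Walls along an irrational ray -/

section

variable {X : Type*} [MetricSpace X] [ProperSpace X] {𝓑 : Set (Set X)} {x₀ : X}

/-- Every segment from `x₀` to the far side passes through the wall, and before that it is a segment
to a point of the wall. So the view of the wall controls that of everything behind it. -/
theorem Gate.dist_ray_le_of_far (hX : IsCAT0 X) (G : Gate 𝓑 x₀) {a : X} {r : ℝ≥0} {δ : ℝ}
    (hr : ∀ q ∈ G.wall, r ≤ dist x₀ q) (h : ∀ q ∈ G.wall, dist a (gpt x₀ q r) ≤ δ) {C : Set X}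
    (hC : C ⊆ G.far) {c : VisualBoundary x₀} (hc : c ∈ asymptoticTo hX x₀ C) :
    dist a (c.ray r) ≤ δ := by
  obtain ⟨y, z, hz, rfl⟩ := hc
  refine le_of_tendsto (tendsto_const_nhds.dist (z.tendsto_rebase hX x₀ r)) ?_
  refine Eventually.of_forall fun n => ?_
  obtain ⟨w, hw, hbtw⟩ := hX.exists_btw_mem_inter G.isClosed_near G.isClosed_far
    G.near_union_far G.base_mem_near (hC (hz n))
  have hww := G.mem_wall hw.1 hw.2
  rw [← hX.gpt_of_btw hbtw r.coe_nonneg (hr w hww)]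
  exact h w hww

theorem exists_gate_sequence (hX : IsCAT0 X) (h𝓑 : IsBlockDecomposition 𝓑)
    {a : VisualBoundary x₀} (ha : IsIrrational 𝓑 a) : ∃ G : ℕ → Gate 𝓑 x₀,
      (∀ n, (G n).Crossed a) ∧ (∀ n, ∀ x ∈ (G n).outer, (n : ℝ) < dist x₀ x) ∧
      ∀ n, (G (n + 1)).outer ⊆ (G n).far := by
  have next : ∀ (g : {g : Gate 𝓑 x₀ // g.Crossed a}) (n : ℕ), ∃ g' : {g : Gate 𝓑 x₀ // g.Crossed a},
      (∀ x ∈ g'.1.outer, (n : ℝ) < dist x₀ x) ∧ g'.1.outer ⊆ g.1.far := by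
    rintro ⟨g, t, ht⟩ n
    -- Beyond radius `t` the ray has already passed `g`, so it meets the outer block of `H` off
    -- `g.near`.
    obtain ⟨H, hH, hHd⟩ := ha.exists_gate hX h𝓑 (max t n)
    obtain ⟨s, hs⟩ := hH
    obtain ⟨u, -, hu, -⟩ := H.exists_crossing hX h𝓑 hs
    have htu : t ≤ u := by
      have := (le_max_left _ _).trans_lt (hHd _ hu.2)
      rw [a.dist_base_ray] at this
      exact_mod_cast this.le
    exact ⟨⟨H, s, hs⟩, fun x hx => (le_max_right _ _).trans_lt (hHd x hx),
      g.subset_far hX h𝓑 H.outer_mem hu.2 (g.not_mem_near_of_le hX h𝓑 ht htu)⟩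
  choose f hf1 hf2 using next
  obtain ⟨g₀, hg₀, hg₀'⟩ := ha.exists_gate hX h𝓑 0
  let G : ℕ → {g : Gate 𝓑 x₀ // g.Crossed a} := fun n =>
    Nat.rec ⟨g₀, hg₀⟩ (fun n g => f g (n + 1)) n
  refine ⟨fun n => (G n).1, fun n => (G n).2, fun n => ?_, fun n => hf2 (G n) (n + 1)⟩
  cases n with
  | zero => exact_mod_cast hg₀'
  | succ n => exact hf1 (G n) (n + 1)

theorem exists_ultrafilter_of_frequently {ι : Type*} {l : Filter ι} {p : ι → Prop}
    (h : ∃ᶠ i in l, p i) : ∃ U : Ultrafilter ι, ↑U ≤ l ∧ ∀ᶠ i in (U : Filter ι), p i := by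
  have : (l ⊓ 𝓟 {i | p i}).NeBot := frequently_mem_iff_neBot.1 h
  have hU := Ultrafilter.of_le (l ⊓ 𝓟 {i | p i})
  exact ⟨_, hU.trans inf_le_left, le_principal_iff.1 (hU.trans inf_le_right)⟩

/-- Either the walls passed by an irrational ray shrink to the ray, or the ray can be joined to a
rational ray. -/
theorem eventually_forall_wall_dist_le (hX : IsCAT0 X) (h𝓑 : IsBlockDecomposition 𝓑)
    (hx₀ : ∀ W ∈ walls 𝓑, x₀ ∉ W) {a : VisualBoundary x₀} (ha : IsLonely 𝓑 a)
    {G : ℕ → Gate 𝓑 x₀} (hG : ∀ n, (G n).Crossed a)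
    (hGd : ∀ n, ∀ x ∈ (G n).outer, (n : ℝ) < dist x₀ x)
    (hjoin : ∀ c, Joined a c → IsIrrational 𝓑 c) (r : ℝ≥0) {δ : ℝ} (hδ : 0 < δ) :
    ∀ᶠ n in atTop, ∀ q ∈ (G n).wall, dist (a.ray r) (gpt x₀ q r) ≤ δ := by
  rcases eq_or_lt_of_le (zero_le (a := r)) with rfl | hr
  · refine Eventually.of_forall fun n q _ => ?_
    rw [a.ray_zero, NNReal.coe_zero, (hX.gpt_spec x₀ q le_rfl dist_nonneg).1]
    exact hδ.le
  by_contra hcon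
  obtain ⟨U, hU, hbad⟩ := exists_ultrafilter_of_frequently (not_eventually.1 hcon)
  have hr' : (0 : ℝ) < r := hr
  have hcross : ∀ n, ∃ t, a.ray t ∈ (G n).wall := fun n => by
    obtain ⟨t, ht⟩ := hG n
    obtain ⟨s, -, hs, -⟩ := (G n).exists_crossing hX h𝓑 ht
    exact ⟨s, hs⟩
  choose t ht using hcross
  have hnat : Tendsto (fun n : ℕ => (n : ℝ)) U atTop := tendsto_natCast_atTop_atTop.mono_left hU
  -- `q` is seen far from `a`; `y`, found by the intermediate value theorem, is seen at distance `δ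
  -- / 2`, so that its limit differs both from `a` and from the limit of `q`. The implication lets
  -- both be chosen for every `n`, with the junk value `x₀` elsewhere.
  have hex : ∀ n : ℕ, ∃ q y : X, ((r : ℝ) ≤ n ∧
      ¬ ∀ q ∈ (G n).wall, dist (a.ray r) (gpt x₀ q r) ≤ δ) →
      q ∈ (G n).wall ∧ y ∈ (G n).wall ∧ MetricBtw (a.ray (t n)) y q ∧
        δ < dist (a.ray r) (gpt x₀ q r) ∧ dist (a.ray r) (gpt x₀ y r) = δ / 2 := by
    intro n
    by_cases hn : (r : ℝ) ≤ n ∧ ¬ ∀ q ∈ (G n).wall, dist (a.ray r) (gpt x₀ q r) ≤ δ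
    swap
    · exact ⟨x₀, x₀, fun h => absurd h hn⟩
    obtain ⟨hrn, h⟩ := hn
    push Not at h
    obtain ⟨q, hq, hqd⟩ := h
    have hfar : ∀ l ∈ Set.Icc (0 : ℝ) 1, seg (a.ray (t n)) q l ∈ (G n).wall := fun l hl =>
      hX.seg_mem ((G n).wall_convex h𝓑) (ht n) hq hl.1 hl.2
    have hge : ∀ p ∈ (G n).wall, (r : ℝ) ≤ dist x₀ p := fun p hp =>
      hrn.trans (hGd n p hp.2).le
    have hcont : ContinuousOn (fun l => dist (a.ray r) (gpt x₀ (seg (a.ray (t n)) q l) r))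
        (Set.Icc (0 : ℝ) 1) := by
      refine Continuous.comp_continuousOn (g := fun z => dist (a.ray r) z) (by fun_prop) ?_
      have h1 := hX.continuousOn_seg_param (a.ray (t n)) q
      refine hX.continuousOn_seg.comp (f := fun l =>
        (x₀, seg (a.ray (t n)) q l, (r : ℝ) / dist x₀ (seg (a.ray (t n)) q l))) ?_ ?_
      · refine continuousOn_const.prodMk (h1.prodMk (continuousOn_const.div
          (Continuous.comp_continuousOn (g := fun z => dist x₀ z) (by fun_prop) h1) ?_))
        intro l hl
        exact (hr'.trans_le (hge _ (hfar l hl))).ne'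
      · intro l hl
        exact ⟨by positivity, div_le_one_of_le₀ (hge _ (hfar l hl)) dist_nonneg⟩
    have hmem : δ / 2 ∈ Set.Icc (dist (a.ray r) (gpt x₀ (seg (a.ray (t n)) q 0) r))
        (dist (a.ray r) (gpt x₀ (seg (a.ray (t n)) q 1) r)) := by
      rw [hX.seg_zero, hX.seg_one]
      refine ⟨?_, by linarith⟩
      have hrt : r ≤ t n := by
        have := hge _ (ht n)
        rwa [a.dist_base_ray, NNReal.coe_le_coe] at this
      rw [a.gpt_ray hX hrt, dist_self]
      positivity
    obtain ⟨l, hl, hle⟩ := intermediate_value_Icc zero_le_one hcont hmem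
    exact ⟨q, seg (a.ray (t n)) q l, fun _ =>
      ⟨hq, hfar l hl, hX.btw_seg _ _ hl.1 hl.2, hqd, hle⟩⟩
  choose q y hqy using hex
  have hev : ∀ᶠ n in (U : Filter ℕ), q n ∈ (G n).wall ∧ y n ∈ (G n).wall ∧
      MetricBtw (a.ray (t n)) (y n) (q n) ∧ δ < dist (a.ray r) (gpt x₀ (q n) r) ∧
      dist (a.ray r) (gpt x₀ (y n) r) = δ / 2 := by
    filter_upwards [hbad, hnat.eventually_ge_atTop (r : ℝ)] with n h1 h2
    exact hqy n ⟨h2, h1⟩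
  have hqd : Tendsto (fun n => dist x₀ (q n)) U atTop :=
    tendsto_atTop_mono' _ (by filter_upwards [hev] with n hn; exact (hGd n _ hn.1.2).le) hnat
  have hyd : Tendsto (fun n => dist x₀ (y n)) U atTop :=
    tendsto_atTop_mono' _ (by filter_upwards [hev] with n hn; exact (hGd n _ hn.2.1.2).le) hnat
  obtain ⟨b, hb⟩ := exists_limit hX x₀ U q hqd
  obtain ⟨c, hc⟩ := exists_limit hX x₀ U y hyd
  have hac : dist (a.ray r) (c.ray r) = δ / 2 := by
    refine tendsto_nhds_unique (tendsto_const_nhds.dist (hc r)) (tendsto_const_nhds.congr' ?_)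
    filter_upwards [hev] with n hn
    exact hn.2.2.2.2.symm
  have hab : δ ≤ dist (a.ray r) (b.ray r) := by
    refine ge_of_tendsto (tendsto_const_nhds.dist (hb r)) ?_
    filter_upwards [hev] with n hn
    exact hn.2.2.2.1.le
  have hcb : δ / 2 ≤ dist (c.ray r) (b.ray r) := by
    have := dist_triangle (a.ray r) (c.ray r) (b.ray r)
    linarith
  have hsq : ∀ s : ℝ≥0, 0 < s →
      dist (a.ray s) (c.ray s) ^ 2 + dist (c.ray s) (b.ray s) ^ 2 ≤ 4 * (s : ℝ) ^ 2 := by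
    intro s hs
    refine le_of_tendsto (((tendsto_const_nhds.dist (hc s)).pow 2).add
      (((hc s).dist (hb s)).pow 2)) ?_
    filter_upwards [hev, hnat.eventually_ge_atTop (s : ℝ)] with n hn hsn
    have hst : (s : ℝ) ≤ dist x₀ (a.ray (t n)) := hsn.trans (hGd n _ (ht n).2).le
    have hst' : s ≤ t n := by rwa [a.dist_base_ray, NNReal.coe_le_coe] at hst
    rw [← a.gpt_ray hX hst']
    exact hX.dist_gpt_sq_add_le hn.2.2.1 hs hst (hsn.trans (hGd n _ hn.2.1.2).le)
      (hsn.trans (hGd n _ hn.1.2).le)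
  -- The distance from `c` to `b` grows at rate at least `m` from time `r` on, so `hsq` leaves rate
  -- at most `√(4 - m ^ 2) < 2` for `a` and `c`.
  have hjac : Joined a c := by
    set m : ℝ := δ / 2 / r with hm
    have hm0 : 0 < m := by positivity
    refine joined_of_dist_ray_le hX a c (k := √(4 - m ^ 2)) ?_ r fun s hs => ?_
    · rw [Real.sqrt_lt' two_pos]
      nlinarith
    · have hs0 : 0 < s := hr.trans_le hs
      have h1 := c.mul_dist_ray_le hX b hs
      have h2 : (s : ℝ) * m ≤ dist (c.ray s) (b.ray s) := by
        have h3 : (s : ℝ) * (δ / 2) ≤ s * dist (c.ray r) (b.ray r) := by gcongr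
        rw [hm, mul_div_assoc', div_le_iff₀ hr']
        linarith
      have h4 : ((s : ℝ) * m) ^ 2 ≤ dist (c.ray s) (b.ray s) ^ 2 := by gcongr
      have h5 := hsq s hs0
      have h6 : √(4 - m ^ 2) * s = √((4 - m ^ 2) * (s : ℝ) ^ 2) := by
        rw [Real.sqrt_mul' _ (sq_nonneg _), Real.sqrt_sq s.coe_nonneg]
      rw [h6]
      refine Real.le_sqrt_of_sq_le ?_
      nlinarith
  have hci := hjoin c hjac
  have h1 : ∀ H : Gate 𝓑 x₀, H.Crossed c → H.Crossed a := fun H hH =>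
    hH.of_limit hX h𝓑 hG (by filter_upwards [hev] with n hn; exact hn.2.1) hyd hc
  have h2 : ∀ H : Gate 𝓑 x₀, H.Crossed a → H.Crossed c := fun H hH =>
    hH.of_isIrrational hX h𝓑 hci h1
  have heq := ha.2 c (Gate.sameItinerary hX h𝓑 hx₀ fun H => ⟨h1 H, h2 H⟩)
  rw [heq, dist_self] at hac
  linarith

end

/-! ### The theorem -/

theorem mainTheorem3 {X : Type*} [MetricSpace X] [ProperSpace X] (hX : IsCAT0 X)
    (𝓑 : Set (Set X)) (h𝓑 : IsBlockDecomposition 𝓑)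
    (hblock : ∀ B ∈ 𝓑, ∀ b : B, PathConnectedSpace (VisualBoundary b))
    (hwall : ∀ W ∈ walls 𝓑, ∀ w : W, Nonempty (VisualBoundary w))
    (x₀ : X) (hx₀ : ∀ W ∈ walls 𝓑, x₀ ∉ W)
    (hlonely : ∀ α : VisualBoundary x₀, IsIrrational 𝓑 α → IsLonely 𝓑 α) :
    ∀ x : X, PathConnectedSpace (VisualBoundary x) := by
  have hasym : ∀ B ∈ 𝓑, B.Nonempty → (asymptoticTo hX x₀ B).Nonempty := by
    rintro B hB ⟨b, hb⟩
    have := hblock B hB ⟨b, hb⟩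
    exact asymptoticTo_nonempty hX x₀ ⟨b, hb⟩
  obtain ⟨B₀, hB₀, hxB₀⟩ := h𝓑.exists_mem x₀
  obtain ⟨a₀, ha₀⟩ := hasym B₀ hB₀ ⟨x₀, hxB₀⟩
  have huniv : IsPreconnected (Set.univ : Set X) :=
    hX.isPreconnected fun _ _ _ _ _ _ => Set.mem_univ _
  have hblocks : ∀ C ∈ 𝓑, C.Nonempty → ∀ c ∈ asymptoticTo hX x₀ C, Joined a₀ c := by
    intro C hC hne c hc
    refine (joinedIn_iUnion_asymptoticTo hX h𝓑 hblock hwall x₀ huniv (fun x _ => ?_) hB₀ hC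
      (Set.subset_univ _) (Set.subset_univ _) ⟨x₀, hxB₀⟩ hne ha₀ hc).joined
    obtain ⟨D, hD, hxD⟩ := h𝓑.exists_mem x
    exact ⟨D, hD, Set.subset_univ _, hxD⟩
  have hrat : ∀ c : VisualBoundary x₀, ¬ IsIrrational 𝓑 c → Joined a₀ c := by
    intro c hc
    obtain ⟨B, hB, hne, hcB⟩ := exists_mem_asymptoticTo hX h𝓑 x₀ hc
    exact hblocks B hB hne c hcB
  have hall : ∀ c : VisualBoundary x₀, Joined a₀ c := by
    intro a
    -- A ray that can be joined to a rational one is done; otherwise `hjoin` is what makes the walls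
    -- shrink to `a`.
    by_cases hjoin : ∀ c, Joined a c → IsIrrational 𝓑 c
    swap
    · push Not at hjoin
      obtain ⟨c, hac, hc⟩ := hjoin
      exact (hrat c hc).trans hac.symm
    have ha := hjoin a (Joined.refl a)
    obtain ⟨G, hG, hGd, hGf⟩ := exists_gate_sequence hX h𝓑 ha
    have hne : ∀ n, (G n).outer.Nonempty := fun n =>
      (G n).wall_nonempty.mono Set.inter_subset_right
    choose b hb using fun n => hasym _ (G n).outer_mem (hne n)
    refine (hblocks _ (G 0).outer_mem (hne 0) _ (hb 0)).trans ?_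
    refine joined_of_joinedIn_of_tendsto
      (P := fun n => ⋃ D ∈ {D ∈ 𝓑 | D ⊆ (G n).far}, asymptoticTo hX x₀ D) (fun n => ?_) ?_
    · exact joinedIn_iUnion_asymptoticTo hX h𝓑 hblock hwall x₀
        (hX.isPreconnected ((G n).far_convex hX h𝓑))
        (fun x hx => (G n).exists_block_subset_far hX h𝓑 hx) (G n).outer_mem (G (n + 1)).outer_mem
        (G n).outer_subset (hGf n) (hne n) (hne (n + 1)) (hb n) (hb (n + 1))
    · refine tendsto_smallSets fun r δ hδ => ?_
      filter_upwards [eventually_forall_wall_dist_le hX h𝓑 hx₀ (hlonely a ha) hG hGd hjoin r hδ,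
        (tendsto_natCast_atTop_atTop (R := ℝ)).eventually_ge_atTop (r : ℝ)] with n h1 h2 c hc
      obtain ⟨D, hD, hcD⟩ := Set.mem_iUnion₂.1 hc
      exact (G n).dist_ray_le_of_far hX (fun q hq => h2.trans (hGd n q hq.2).le) h1 hD.2 hcD
  have hpc : PathConnectedSpace (VisualBoundary x₀) :=
    ⟨⟨a₀⟩, fun c d => (hall c).symm.trans (hall d)⟩
  intro x
  -- Path connectedness passes to any other base point, along the continuous surjection given by
  -- asymptotic rays.
  refine Function.Surjective.pathConnectedSpace (f := fun c : VisualBoundary x₀ => c.rebase hX x)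
    (fun c => ⟨c.rebase hX x₀, ?_⟩) (continuous_rebase hX x₀ x)
  change (c.rebase hX x₀).rebase hX x = c
  rw [rebase_rebase, rebase_self]
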